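/- Let $F$ be a field. A \emph{filtered complex} $\mathcal K$ over $F$ is a finite chain complex with a distinguished finite basis of cells: a finite set of cells, each with a dimension in $\mathbb N$, incidence indices $\kappa(A,b)\in F$ (the coefficient of $b$ in $\partial A$) that vanish unless $\dim A=\dim b+1$, with $\partial\partial=0$, and a filtering function $g$ from the cells to $\mathbb Z$ with $g(b)\le g(A)$ whenever $\kappa(A,b)\ne 0$. Put $\mathcal K_t=g^{-1}(-\infty,t]$ for $t \in \mathbb Z$, and $\mathcal K_\infty=\mathcal K$. A \emph{compatible Morse matching} on $\mathcal K$ is a set of pairwise disjoint pairs $(b,A)$ of cells with $\kappa(A,b)\neq 0$ and $g(b)=g(A)$, such that the Morse graph (an edge $A\to b$ whenever $\kappa(A,b)\ne0$, reversed if $(b,A)$ is a matched pair) has no directed cycle. The unmatched cells are called critical. The \emph{Morse complex} of the matching has the critical cells as cells, with inherited dimensions and values of $g$, and the incidence index of critical cells $s,t$ is the sum over all paths $s\to b_0\to A_0\to b_1\to\dots\to A_{n-1}\to b_n=t$ ($n\ge 0$) in the Morse graph, where $b_i$ is matched with $A_i$ for $i<n$ and $b_{i+1}\neq b_i$ is a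 face of $A_i$, of $\kappa(s,b_0)\prod_{i<n}\bigl(-\kappa(A_i,b_{i+1})/\kappa(A_i,b_i)\bigr)$ (for $F=\mathbb Z_2$: the number of such paths modulo $2$). Let $\mathbb M$ assign to every filtered complex $\mathcal K$ the Morse complex $\mathbb M(\mathcal K)$ of a compatible Morse matching on $\mathcal K$. Assume that $\mathbb M$ is \emph{vital}: if $\mathcal K$ has a nonempty compatible Morse matching, then the one used for $\mathbb M(\mathcal K)$ is nonempty. An \emph{iterated Morse complex} $\mathbb M^\infty(\mathcal K)$ is a member $N$ of the sequence $\mathcal K,\mathbb M(\mathcal K),\mathbb M^2(\mathcal K),\dots$ that is a fixed point, i.e. there is a bijection between the cells of $\mathbb M(N)$ and of $N$ that preserves dimensions, incidence indices and $g$. \emph{Persistence.} For $s\le t\le\infty$ let $\beta_p^{s,t}$ be the rank of the map $H_p(\mathcal K_s)\to H_p(\mathcal K_t)$ induced by inclusion. In dimension $p$, the interval from $i$ to $j$ ($i<j$ in $\mathbb Z$) has multiplicity $(\beta_p^{i,j-1}-\beta_p^{i,j})-(\beta_p^{i-1,j-1}-\beta_p^{i-1,j})$, and the interval from $i$ to $\infty$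 has multiplicity $\beta_p^{i,\infty}-\beta_p^{i-1,\infty}$. Two filtered complexes have the same persistence if all these multiplicities agree. \emph{Cells and intervals.} Order the cells so that $g$ is nondecreasing, and let $R$ be a reduced matrix obtained from the boundary matrix (the column of a cell $A$ is $\partial A$) by adding to columns multiples of earlier columns of cells of the same dimension; reduced means that distinct nonzero columns have their lowest nonzero entries in different rows. If the lowest nonzero entry of the column of $A$ is in row $b$, then $A$ \emph{kills} the class created by $b$ and terminates the interval from $g(b)$ to $g(A)$ in dimension $\dim b$. If the column of $A$ is zero, then $A$ starts the interval in dimension $\dim A$ from $g(A)$ to $g(B)$ if a cell $B$ kills the class created by $A$, and from $g(A)$ to $\infty$ if no cell does. \textbf{Theorem.} Let $\mathbb M$ be vital and let $\mathcal K$ be a filtered complex over $F$. Then an iterated Morse complex $\mathbb M^\infty(\mathcal K)$ exists, and for each such complex: (Correctness) $\mathcal K$ and $\mathbb M^\infty(\mathcal K)$ have the same persistence. (Optimality) For every ordering of the cells of $\mathbb M^\infty(\mathcal K)$ with $g$ nondecreasing, a reduced matrix $R$ exists, and with respect to every such $R$ each cell of $\mathbb M^\infty(\mathcal K)$ either starts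 or terminates an interval of nonzero length (the two endpoints are distinct), and this interval has positive multiplicity in the persistence of $\mathbb M^\infty(\mathcal K)$. -/

import Mathlib

universe u v

/-- A finite chain complex over the field `F` with a distinguished basis of cells, together with an
integer valued filtering function `g` on the cells.  `inc A b` is the incidence index of `A` and
`b`, i.e. the coefficient of `b` in the boundary of `A`. -/
structure FilteredComplex (F : Type v) [Field F] where
  Cell : Type u
  [fintypeCell : Fintype Cell]
  dim : Cell → ℕ
  inc : Cell → Cell → F
  g : Cell → ℤ
  dim_eq : ∀ A b, inc A b ≠ 0 → dim A = dim b + 1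
  inc_inc : ∀ A c, ∑ b, inc A b * inc b c = 0
  g_le : ∀ A b, inc A b ≠ 0 → g b ≤ g A

attribute [instance] FilteredComplex.fintypeCell

namespace FilteredComplex

variable {F : Type v} [Field F]

/-! ### Sublevel complexes, persistent homology, persistence intervals -/

section Persistence

variable (K : FilteredComplex.{u} F)

/-- The `p`-chains of the sublevel complex `K_t = g⁻¹(-∞, t]`; for `t = ⊤` this is all of `K`. -/
def chains (p : ℕ) (t : WithTop ℤ) : Submodule F (K.Cell → F) where
  carrier := {c | ∀ x, c x ≠ 0 → K.dim x = p ∧ (K.g x : WithTop ℤ) ≤ t}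
  zero_mem' := fun x hx => absurd rfl hx
  add_mem' := by
    intro a b ha hb x hx
    by_cases h : a x = 0
    · exact hb x (fun h' => hx (by simp [h, h']))
    · exact ha x h
  smul_mem' := by
    intro r a ha x hx
    exact ha x (fun h => hx (by simp [h]))

/-- The boundary operator, extended linearly from cells to chains. -/
def boundary : (K.Cell → F) →ₗ[F] (K.Cell → F) where
  toFun c := fun b => ∑ A, c A * K.inc A b
  map_add' := by
    intro c d
    funext b
    simp [add_mul, Finset.sum_add_distrib]
  map_smul' := by
    intro r c
    funext b
    simp [Finset.mul_sum, mul_assoc]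

/-- `Z_p(K_t)` -/
def cycles (p : ℕ) (t : WithTop ℤ) : Submodule F (K.Cell → F) :=
  K.chains p t ⊓ LinearMap.ker K.boundary

/-- `B_p(K_t)` -/
def boundaries (p : ℕ) (t : WithTop ℤ) : Submodule F (K.Cell → F) :=
  (K.chains (p + 1) t).map K.boundary

/-- `H_p(K_t) = Z_p(K_t) / B_p(K_t)` -/
abbrev Homology (p : ℕ) (t : WithTop ℤ) : Type (max u v) :=
  (K.cycles p t) ⧸ (K.boundaries p t).submoduleOf (K.cycles p t)

theorem chains_mono (p : ℕ) {s t : WithTop ℤ} (h : s ≤ t) : K.chains p s ≤ K.chains p t :=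
  fun _ hc x hx => ⟨(hc x hx).1, (hc x hx).2.trans h⟩

theorem cycles_mono (p : ℕ) {s t : WithTop ℤ} (h : s ≤ t) : K.cycles p s ≤ K.cycles p t :=
  inf_le_inf_right _ (K.chains_mono p h)

theorem boundaries_mono (p : ℕ) {s t : WithTop ℤ} (h : s ≤ t) :
    K.boundaries p s ≤ K.boundaries p t :=
  Submodule.map_mono (K.chains_mono (p + 1) h)

/-- The map `f^{s,t} : H_p(K_s) → H_p(K_t)` induced by the inclusion `K_s ⊆ K_t`. -/
def homologyMap (p : ℕ) {s t : WithTop ℤ} (h : s ≤ t) :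
    K.Homology p s →ₗ[F] K.Homology p t :=
  Submodule.mapQ _ _ (Submodule.inclusion (K.cycles_mono p h))
    (fun _ hx => K.boundaries_mono p h hx)

open Classical in
/-- The rank of the persistent homology group `H_p^{s,t} = im f^{s,t}` (used only for `s ≤ t`). -/
noncomputable def persistentBetti (p : ℕ) (s t : WithTop ℤ) : ℤ :=
  if h : s ≤ t then (Module.finrank F (LinearMap.range (K.homologyMap p h)) : ℤ) else 0

/-- The multiplicity, in the `p`-dimensional persistence diagram, of the interval from `i` to `j`:
the number of independent `p`-classes that are born at `i` and die entering `j`, respectively never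
die if `j = ⊤`. It is meaningful for `i < j`. -/
noncomputable def intervalMultiplicity (p : ℕ) (i : ℤ) : WithTop ℤ → ℤ
  | none => K.persistentBetti p i ⊤ - K.persistentBetti p (i - 1 : ℤ) ⊤
  | some j =>
      (K.persistentBetti p i (j - 1 : ℤ) - K.persistentBetti p i (j : ℤ)) -
        (K.persistentBetti p (i - 1 : ℤ) (j - 1 : ℤ) - K.persistentBetti p (i - 1 : ℤ) (j : ℤ))

end Persistence

/-- Two filtered complexes have the same persistence if in every dimension they have the same
multiset of persistence intervals (finite and infinite). -/
def SamePersistence (K L : FilteredComplex.{u} F) : Prop :=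
  ∀ (p : ℕ) (i : ℤ) (j : WithTop ℤ), (i : WithTop ℤ) < j →
    K.intervalMultiplicity p i j = L.intervalMultiplicity p i j

/-! ### Intervals started and terminated by cells: the reduced sorted boundary matrix -/

section Reduction

variable (K : FilteredComplex.{u} F)

/-- An enumeration of the cells in which the filtration value is nondecreasing. -/
def IsSorted (pos : K.Cell ≃ Fin (Fintype.card K.Cell)) : Prop :=
  ∀ a b, pos a < pos b → K.g a ≤ K.g b

variable {K}

/-- `R A` is the column of the cell `A`; `IsLow pos R A b` says that the lowest nonzero entry of
this column is in the row of the cell `b`. -/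
def IsLow (pos : K.Cell ≃ Fin (Fintype.card K.Cell)) (R : K.Cell → K.Cell → F)
    (A b : K.Cell) : Prop :=
  R A b ≠ 0 ∧ ∀ c, R A c ≠ 0 → pos c ≤ pos b

/-- `R` is a reduced matrix obtained from the boundary matrix by adding to columns multiples of
earlier columns (of cells of the same dimension): no two columns have the same lowest entry. -/
structure IsReduction (pos : K.Cell ≃ Fin (Fintype.card K.Cell)) (R : K.Cell → K.Cell → F) :
    Prop where
  exists_ops : ∃ V : K.Cell → K.Cell → F,
    (∀ A, V A A = 1) ∧
    (∀ A B, V A B ≠ 0 → pos B ≤ pos A ∧ K.dim B = K.dim A) ∧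
    ∀ A c, R A c = ∑ B, V A B * K.inc B c
  reduced : ∀ A A' b, IsLow pos R A b → IsLow pos R A' b → A = A'

/-- The cell `A` creates a homology class (its reduced column is zero), and the corresponding
persistence interval starts at `g A` and has nonzero length: it ends at `g B` if the class is killed
by the cell `B`, and it is infinite if no cell kills the class. -/
def StartsInterval (pos : K.Cell ≃ Fin (Fintype.card K.Cell)) (R : K.Cell → K.Cell → F)
    (A : K.Cell) : Prop :=
  R A = 0 ∧
    ((∃ B, IsLow pos R B A ∧ K.g A < K.g B ∧
        0 < K.intervalMultiplicity (K.dim A) (K.g A) (K.g B : WithTop ℤ)) ∨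
      ((∀ B, ¬ IsLow pos R B A) ∧ 0 < K.intervalMultiplicity (K.dim A) (K.g A) ⊤))

/-- The cell `A` kills the homology class created by a cell `b`, and the corresponding persistence
interval, from `g b` to `g A`, has nonzero length. -/
def TerminatesInterval (pos : K.Cell ≃ Fin (Fintype.card K.Cell)) (R : K.Cell → K.Cell → F)
    (A : K.Cell) : Prop :=
  ∃ b, IsLow pos R A b ∧ K.g b < K.g A ∧
    0 < K.intervalMultiplicity (K.dim b) (K.g b) (K.g A : WithTop ℤ)

end Reduction

/-! ### Morse matchings compatible with the filtration, and the Morse complex -/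

/-- The Morse graph of the pairs `rel b A` (`b` is a face matched with its coface `A`): an edge from
each cell to each of its faces, reversed for matched pairs. -/
def MorseEdge (K : FilteredComplex.{u} F) (rel : K.Cell → K.Cell → Prop) (x y : K.Cell) : Prop :=
  (K.inc x y ≠ 0 ∧ ¬ rel y x) ∨ rel x y

/-- An acyclic Morse matching compatible with the filtration; `rel b A` says that `b` is matched
with its coface `A`. -/
structure Matching (K : FilteredComplex.{u} F) where
  rel : K.Cell → K.Cell → Prop
  inc_ne_zero : ∀ b A, rel b A → K.inc A b ≠ 0
  unique_upper : ∀ b A A', rel b A → rel b A' → A = A'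
  unique_lower : ∀ b b' A, rel b A → rel b' A → b = b'
  not_both : ∀ b A C, rel b A → ¬ rel A C
  acyclic : ∀ x, ¬ Relation.TransGen (K.MorseEdge rel) x x
  compatible : ∀ b A, rel b A → K.g b = K.g A

namespace Matching

variable {K : FilteredComplex.{u} F} (M : K.Matching)

/-- Some pair of cells is matched. -/
def IsNonempty : Prop := ∃ b A, M.rel b A

/-- A cell is critical if it is not matched. -/
def Critical (x : K.Cell) : Prop := ∀ y, ¬ M.rel x y ∧ ¬ M.rel y x

open Classical in
/-- The sum of the weights of the `V`-paths `b = b₀ → A₀ → b₁ → A₁ → ⋯ → bₙ = t` in the Morse graph,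
where `bᵢ` is matched with `Aᵢ` and `bᵢ₊₁ ≠ bᵢ` is a face of `Aᵢ`. The weight of a path is the product
of the numbers `-inc Aᵢ bᵢ₊₁ / inc Aᵢ bᵢ`; it is `1` for coefficients in the field with two
elements, so that then paths are counted modulo two. -/
noncomputable def pathWeight : ℕ → K.Cell → K.Cell → F
  | 0, b, t => if b = t then 1 else 0
  | n + 1, b, t => ∑ b', (∑ A, if M.rel b A ∧ b' ≠ b then -(K.inc A b' / K.inc A b) else 0) *
      pathWeight n b' t

/-- The incidence index of `s` and `t` in the Morse complex: the weighted number of paths from `s`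
to `t` in the Morse graph, that begin with an edge from `s` to a face of `s` and go on along a
`V`-path. In an acyclic graph no vertex is repeated on a path, which bounds the length `n`. -/
noncomputable def morseInc (s t : K.Cell) : F :=
  ∑ n ∈ Finset.range (Fintype.card K.Cell), ∑ b, K.inc s b * M.pathWeight n b t

section Proofs

open Classical in
/-- The matrix of one step `b → A → b'` of a `V`-path. -/
noncomputable def stepMatrix : Matrix K.Cell K.Cell F :=
  Matrix.of fun b b' => ∑ A, if M.rel b A ∧ b' ≠ b then -(K.inc A b' / K.inc A b) else 0

open Classical in
theorem pathWeight_eq (n : ℕ) : Matrix.of (M.pathWeight n) = M.stepMatrix ^ n := by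
  induction n with
  | zero =>
    ext b t
    simp [pathWeight, Matrix.one_apply]
  | succ n ih =>
    rw [pow_succ', ← ih]
    ext b t
    simp [pathWeight, Matrix.mul_apply, stepMatrix]

theorem exists_of_stepMatrix_ne_zero {b b' : K.Cell} (h : M.stepMatrix b b' ≠ 0) :
    ∃ A, M.rel b A ∧ b' ≠ b ∧ K.inc A b' ≠ 0 := by
  classical
  obtain ⟨A, -, hA⟩ := Finset.exists_ne_zero_of_sum_ne_zero h
  by_cases hc : M.rel b A ∧ b' ≠ b
  · refine ⟨A, hc.1, hc.2, fun h0 => hA ?_⟩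
    simp [h0]
  · exact absurd (if_neg hc) hA

theorem transGen_of_step {b b' A : K.Cell} (h : M.rel b A) (hne : b' ≠ b)
    (hi : K.inc A b' ≠ 0) : Relation.TransGen (K.MorseEdge M.rel) b b' :=
  (Relation.TransGen.single (show K.MorseEdge M.rel b A from Or.inr h)).tail
    (show K.MorseEdge M.rel A b' from Or.inl ⟨hi, fun h' => hne (M.unique_lower _ _ _ h' h)⟩)

open Classical in
theorem stepMatrix_pow_card : M.stepMatrix ^ (Fintype.card K.Cell) = 0 := by
  let r : K.Cell → ℕ := fun b =>
    (Finset.univ.filter fun x => Relation.TransGen (K.MorseEdge M.rel) b x).card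
  have key : ∀ n b t, (M.stepMatrix ^ n) b t ≠ 0 → r t + n ≤ r b := by
    intro n
    induction n with
    | zero =>
      intro b t h
      have : b = t := by
        by_contra hne
        exact h (by simp [hne])
      simp [this]
    | succ n ih =>
      intro b t h
      rw [pow_succ', Matrix.mul_apply] at h
      obtain ⟨b', -, hb'⟩ := Finset.exists_ne_zero_of_sum_ne_zero h
      have h1 := ih b' t (right_ne_zero_of_mul hb')
      obtain ⟨A, hA, hne, hi⟩ := M.exists_of_stepMatrix_ne_zero (left_ne_zero_of_mul hb')
      have hp := M.transGen_of_step hA hne hi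
      have h2 : r b' < r b := by
        apply Finset.card_lt_card
        rw [Finset.ssubset_iff_of_subset]
        · exact ⟨b', by simpa using hp, by simpa using M.acyclic b'⟩
        · intro x hx
          simp only [Finset.mem_filter, Finset.mem_univ, true_and] at hx ⊢
          exact hp.trans hx
      omega
  ext b t
  by_contra h
  have h1 := key _ b t h
  have h2 : r b < Fintype.card K.Cell := by
    rw [← Finset.card_univ]
    apply Finset.card_lt_card
    rw [Finset.ssubset_iff_of_subset (Finset.subset_univ _)]
    exact ⟨b, by simp, by simpa using M.acyclic b⟩
  omega

open Classical in
theorem morseInc_eq :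
    Matrix.of M.morseInc = Matrix.of K.inc *
      ∑ n ∈ Finset.range (Fintype.card K.Cell), M.stepMatrix ^ n := by
  ext s t
  rw [Finset.mul_sum, Matrix.sum_apply]
  simp only [Matrix.of_apply, morseInc, ← pathWeight_eq, Matrix.mul_apply]

theorem exists_of_morseInc_ne_zero {s t : K.Cell} (h : M.morseInc s t ≠ 0) :
    ∃ n b, K.inc s b ≠ 0 ∧ M.pathWeight n b t ≠ 0 := by
  obtain ⟨n, -, hn⟩ := Finset.exists_ne_zero_of_sum_ne_zero h
  obtain ⟨b, -, hb⟩ := Finset.exists_ne_zero_of_sum_ne_zero hn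
  exact ⟨n, b, left_ne_zero_of_mul hb, right_ne_zero_of_mul hb⟩

theorem pathWeight_dim_g (n : ℕ) : ∀ b t, M.pathWeight n b t ≠ 0 →
    K.dim b = K.dim t ∧ K.g t ≤ K.g b := by
  induction n with
  | zero =>
    intro b t h
    have : b = t := by
      by_contra hne
      exact h (by simp [pathWeight, hne])
    simp [this]
  | succ n ih =>
    intro b t h
    obtain ⟨b', -, hb'⟩ := Finset.exists_ne_zero_of_sum_ne_zero h
    obtain ⟨A, hA, -, hi⟩ := M.exists_of_stepMatrix_ne_zero (left_ne_zero_of_mul hb')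
    have h1 := ih b' t (right_ne_zero_of_mul hb')
    have h2 := K.dim_eq _ _ hi
    have h3 := K.dim_eq _ _ (M.inc_ne_zero _ _ hA)
    have h4 := K.g_le _ _ hi
    have h5 := M.compatible _ _ hA
    omega

open Classical in
theorem morseInc_morseInc (s u : K.Cell) (hu : M.Critical u) :
    ∑ t : {x // M.Critical x}, M.morseInc s t * M.morseInc t u = 0 := by
  set D : Matrix K.Cell K.Cell F := Matrix.of K.inc with hD
  set T := M.stepMatrix with hT
  set S := ∑ n ∈ Finset.range (Fintype.card K.Cell), T ^ n with hS
  have hDS : ∀ x y, M.morseInc x y = (D * S) x y := fun x y => by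
    rw [← M.morseInc_eq]; rfl
  have hST : S * (1 - T) = 1 := by
    rw [hS, geom_sum_mul_neg, M.stepMatrix_pow_card, sub_zero]
  have hTS : (1 - T) * S = 1 := by
    rw [hS, mul_neg_geom_sum, M.stepMatrix_pow_card, sub_zero]
  have hDD : D * D = 0 := by
    ext A c
    simpa [Matrix.mul_apply, hD] using K.inc_inc A c
  let W : Matrix K.Cell K.Cell F :=
    Matrix.of fun b A => if M.rel b A then (K.inc A b)⁻¹ else 0
  let N : Matrix K.Cell K.Cell F :=
    Matrix.diagonal fun b => if ∃ A, M.rel b A then 0 else 1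
  let U : Matrix K.Cell K.Cell F :=
    Matrix.diagonal fun A => if ∃ b, M.rel b A then 1 else 0
  let C : Matrix K.Cell K.Cell F :=
    Matrix.diagonal fun x => if M.Critical x then 1 else 0
  have hWX : ∀ (X : Matrix K.Cell K.Cell F) b A y, M.rel b A →
      (W * X) b y = (K.inc A b)⁻¹ * X A y := by
    intro X b A y h
    rw [Matrix.mul_apply, Finset.sum_eq_single A]
    · simp [W, h]
    · intro A' _ hne
      have : ¬ M.rel b A' := fun h' => hne (M.unique_upper _ _ _ h' h)
      simp [W, this]
    · simp
  have hWX0 : ∀ (X : Matrix K.Cell K.Cell F) b y, (¬ ∃ A, M.rel b A) → (W * X) b y = 0 := by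
    intro X b y h
    rw [Matrix.mul_apply]
    apply Finset.sum_eq_zero
    intro A _
    have : ¬ M.rel b A := fun h' => h ⟨A, h'⟩
    simp [W, this]
  have hT1 : 1 - T = N + W * D := by
    ext b b'
    rw [Matrix.sub_apply, Matrix.add_apply]
    by_cases h : ∃ A, M.rel b A
    · obtain ⟨A, hA⟩ := h
      have hTb : T b b' = if b' ≠ b then -(K.inc A b' / K.inc A b) else 0 := by
        change ∑ A, _ = _
        rw [Finset.sum_eq_single A]
        · simp [hA]
        · intro A' _ hne
          have : ¬ M.rel b A' := fun h' => hne (M.unique_upper _ _ _ h' hA)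
          simp [this]
        · simp
      have hN : N b b' = 0 := by
        change Matrix.diagonal _ b b' = _
        rw [Matrix.diagonal_apply]
        simp [show ∃ A, M.rel b A from ⟨A, hA⟩]
      rw [hTb, hN, hWX D b A b' hA]
      by_cases hbb : b' = b
      · subst hbb
        simp [hD, M.inc_ne_zero _ _ hA]
      · simp [hbb, hD, Ne.symm hbb, div_eq_inv_mul]
    · have hTb : T b b' = 0 := by
        by_contra h'
        obtain ⟨A, hA, -⟩ := M.exists_of_stepMatrix_ne_zero h'
        exact h ⟨A, hA⟩
      have hN : N b b' = (1 : Matrix K.Cell K.Cell F) b b' := by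
        change Matrix.diagonal _ b b' = _
        rw [Matrix.diagonal_apply, Matrix.one_apply]
        simp [h]
      rw [hTb, hWX0 D b b' h, hN, sub_zero, add_zero]
  have hNCU : N = C + U := by
    change Matrix.diagonal _ = Matrix.diagonal _ + Matrix.diagonal _
    rw [Matrix.diagonal_add]
    refine congrArg Matrix.diagonal (funext fun x => ?_)
    by_cases h1 : ∃ A, M.rel x A
    · obtain ⟨A, hA⟩ := h1
      have h2 : ¬ ∃ b, M.rel b x := fun ⟨b, hb⟩ => M.not_both _ _ _ hb hA
      have h3 : ¬ M.Critical x := fun h => (h A).1 hA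
      simp [h2, h3, show ∃ A, M.rel x A from ⟨A, hA⟩]
    · by_cases h2 : ∃ b, M.rel b x
      · obtain ⟨b, hb⟩ := h2
        have h3 : ¬ M.Critical x := fun h => (h b).2 hb
        simp [h1, h3, show ∃ b, M.rel b x from ⟨b, hb⟩]
      · have h3 : M.Critical x := fun y => ⟨fun h => h1 ⟨y, h⟩, fun h => h2 ⟨y, h⟩⟩
        simp [h1, h2, h3]
  have hWDS : W * (D * S) = 1 - N * S := by
    rw [← hTS, hT1, ← mul_assoc]
    noncomm_ring
  have hU : ∀ x, (U * (D * S)) x u = 0 := by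
    intro x
    rw [Matrix.diagonal_mul]
    by_cases h : ∃ b, M.rel b x
    · obtain ⟨b, hb⟩ := h
      have h1 := hWX (D * S) b x u hb
      have h2 : b ≠ u := by
        rintro rfl
        exact (hu x).1 hb
      rw [hWDS, Matrix.sub_apply, Matrix.diagonal_mul, Matrix.one_apply_ne h2,
        if_pos ⟨x, hb⟩] at h1
      have h3 : (D * S) x u = 0 := by
        simpa [M.inc_ne_zero _ _ hb] using h1.symm
      rw [h3, mul_zero]
    · rw [if_neg h, zero_mul]
  have hCD : D * S * C * (D * S) = -(D * S * (U * (D * S))) := by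
    have hC : C = (1 - T) - U - W * D := by
      rw [hT1, hNCU]; abel
    calc D * S * C * (D * S)
        = D * (S * (1 - T)) * (D * S) - D * S * (U * (D * S)) - D * S * W * (D * D) * S := by
          rw [hC]; noncomm_ring
      _ = _ := by
          rw [hST, hDD, mul_one, ← mul_assoc D D S, hDD]
          simp
  have h0 : (D * S * C * (D * S)) s u = 0 := by
    rw [hCD, Matrix.neg_apply, Matrix.mul_apply]
    simp [hU]
  rw [Matrix.mul_apply] at h0
  simp only [C, Matrix.mul_diagonal] at h0
  rw [← h0]
  simp only [hDS, mul_ite, mul_one, mul_zero, ite_mul, zero_mul]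
  rw [← Finset.sum_filter]
  exact (Finset.sum_subtype _ (by simp) (fun t => (D * S) s t * (D * S) t u)).symm

end Proofs

open Classical in
/-- The Morse complex of a compatible acyclic matching: its cells are the critical cells, with
inherited dimensions and filtration values. -/
noncomputable def morseComplex : FilteredComplex.{u} F where
  Cell := {x : K.Cell // M.Critical x}
  dim x := K.dim x
  inc s t := M.morseInc s t
  g x := K.g x
  dim_eq := by
    intro s t h
    obtain ⟨n, b, h1, h2⟩ := M.exists_of_morseInc_ne_zero h
    rw [K.dim_eq _ _ h1, (M.pathWeight_dim_g n b t h2).1]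
  inc_inc := fun s u => M.morseInc_morseInc s u u.2
  g_le := by
    intro s t h
    obtain ⟨n, b, h1, h2⟩ := M.exists_of_morseInc_ne_zero h
    exact (M.pathWeight_dim_g n b t h2).2.trans (K.g_le _ _ h1)

end Matching

/-! ### The iterated Morse complex -/

/-- A bijection of cells that preserves dimensions, incidence indices and filtration values. -/
structure Iso (K L : FilteredComplex.{u} F) where
  toEquiv : K.Cell ≃ L.Cell
  dim_eq : ∀ x, L.dim (toEquiv x) = K.dim x
  inc_eq : ∀ x y, L.inc (toEquiv x) (toEquiv y) = K.inc x y
  g_eq : ∀ x, L.g (toEquiv x) = K.g x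

end FilteredComplex

/-- A strategy `𝕄` that chooses an acyclic matching, compatible with the filtration, on each
filtered complex. -/
abbrev MorseStrategy (F : Type v) [Field F] : Type (max v (u + 1)) :=
  ∀ K : FilteredComplex.{u} F, K.Matching

namespace MorseStrategy

variable {F : Type v} [Field F]

/-- Vitality: whenever some matching can be made, at least one is made. -/
def IsVital (𝕄 : MorseStrategy.{u} F) : Prop :=
  ∀ K : FilteredComplex.{u} F, (∃ M : K.Matching, M.IsNonempty) → (𝕄 K).IsNonempty

/-- The Morse complex `𝕄(K)` that is built by the strategy. -/
noncomputable def apply (𝕄 : MorseStrategy.{u} F) (K : FilteredComplex.{u} F) :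
    FilteredComplex.{u} F :=
  (𝕄 K).morseComplex

/-- `N` is the iterated Morse complex `𝕄^∞(K)`: a fixed point (up to isomorphism of filtered
complexes with cells) that is reached by the iteration `K, 𝕄(K), 𝕄²(K), …`. -/
def IsIteratedMorseComplex (𝕄 : MorseStrategy.{u} F) (K N : FilteredComplex.{u} F) : Prop :=
  (∃ n : ℕ, N = 𝕄.apply^[n] K) ∧ Nonempty ((𝕄.apply N).Iso N)

end MorseStrategy

/-! Correctness is a filtered deformation retraction. Chains are row vectors, so matrix products act
from left to right. Let `D` be the boundary matrix, `T` the matrix of one step of a V-path, `S` the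
sum of the powers of `T`, `W` the matrix of inverse matched indices, and `C`, `U` the projections to
the critical cells and to the upper cells of matched pairs. Acyclicity makes `T` nilpotent, so `S`
inverts `1 - T`, and `1 - T = C + U + W * D`. With `D * D = 0` this shows that the critical columns
of `S` and the critical rows of `1 - D * S * W` define chain maps between the complex and its Morse
complex. They compose to the identity on the Morse complex, and to the identity up to the homotopy
`S * W` on the complex. Matched cells have equal filtration value, so everything restricts to
sublevel complexes, and the ranks of the persistence maps agree
(`Matching.persistentBetti_morseComplex`).

A nonempty matching strictly lowers the number of cells and an empty one changes nothing, so the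
iteration reaches a fixed point. There no incidence joins cells of equal value: such a pair alone
would be a compatible matching, and vitality would make the next complex smaller
(`IsVital.g_lt_of_iso`).

For optimality, a reduction provides a filtered basis in which the boundary maps each killer to the
class it kills and everything else to zero (`persistentBetti_normalForm`). Persistent Betti numbers
then count cells (`IsReduction.persistentBetti_eq`), so each pair of a killer and a killed cell with
distinct values, and each unkilled creator, contributes one to the multiplicity of its interval, to
which all other cells contribute nonnegatively. At a fixed point a killer lies strictly above the
cell it kills. -/

namespace FilteredComplex

variable {F : Type v} [Field F]

/-! ### Invariance of persistence under filtered chain homotopy -/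

section HomotopyInvariance

variable {K L : FilteredComplex.{u} F}

/-- A linear map of chain spaces that commutes with the boundary operators and preserves dimensions
and the filtration. -/
structure IsFilteredChainMap (f : (K.Cell → F) →ₗ[F] (L.Cell → F)) : Prop where
  mem_chains : ∀ p t c, c ∈ K.chains p t → f c ∈ L.chains p t
  boundary_comm : ∀ c, L.boundary (f c) = f (K.boundary c)

namespace IsFilteredChainMap

variable {f : (K.Cell → F) →ₗ[F] (L.Cell → F)}

theorem mem_cycles (hf : IsFilteredChainMap f) (p : ℕ) (t : WithTop ℤ) :
    ∀ c ∈ K.cycles p t, f c ∈ L.cycles p t := by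
  intro c hc
  refine ⟨hf.mem_chains p t c hc.1, LinearMap.mem_ker.2 ?_⟩
  rw [hf.boundary_comm, LinearMap.mem_ker.1 hc.2, map_zero]

theorem mem_boundaries (hf : IsFilteredChainMap f) (p : ℕ) (t : WithTop ℤ) :
    ∀ c ∈ K.boundaries p t, f c ∈ L.boundaries p t := by
  rintro _ ⟨d, hd, rfl⟩
  exact ⟨f d, hf.mem_chains _ t d hd, hf.boundary_comm d⟩

/-- The map induced by a filtered chain map in the homology of a sublevel complex. -/
def homology (hf : IsFilteredChainMap f) (p : ℕ) (t : WithTop ℤ) :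
    K.Homology p t →ₗ[F] L.Homology p t :=
  Submodule.mapQ _ _ (f.restrict (hf.mem_cycles p t))
    (fun x hx => hf.mem_boundaries p t x hx)

end IsFilteredChainMap

/-- If the identity of `K` factors through `L` up to a filtered chain homotopy, then the persistent
Betti numbers of `K` are bounded by those of `L`. -/
theorem persistentBetti_le_of_homotopy {f : (K.Cell → F) →ₗ[F] (L.Cell → F)}
    {h : (L.Cell → F) →ₗ[F] (K.Cell → F)} (hf : IsFilteredChainMap f) (hh : IsFilteredChainMap h)
    (H : (K.Cell → F) →ₗ[F] (K.Cell → F))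
    (hH : ∀ p t c, c ∈ K.chains p t → H c ∈ K.chains (p + 1) t)
    (homotopy : ∀ c, h (f c) = c - (H (K.boundary c) + K.boundary (H c)))
    (p : ℕ) (s t : WithTop ℤ) : K.persistentBetti p s t ≤ L.persistentBetti p s t := by
  unfold persistentBetti
  split_ifs with hst
  swap
  · exact le_rfl
  have key : K.homologyMap p hst =
      (hh.homology p t).comp ((L.homologyMap p hst).comp (hf.homology p s)) := by
    apply Submodule.linearMap_qext
    ext1 x
    refine (Submodule.Quotient.eq _).2 ?_
    change (x : K.Cell → F) - h (f x) ∈ K.boundaries p t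
    -- On a cycle the homotopy term applied after the boundary vanishes; the remaining difference is
    -- the boundary of `H x`, which already lies in level `s`.
    have hx : K.boundary x = 0 := LinearMap.mem_ker.1 x.2.2
    rw [homotopy, hx, map_zero, zero_add, sub_sub_cancel]
    exact ⟨H x, K.chains_mono _ hst (hH _ _ _ x.2.1), rfl⟩
  rw [key, LinearMap.range_comp]
  exact_mod_cast (Submodule.finrank_map_le _ _).trans
    (Submodule.finrank_mono (LinearMap.range_comp_le_range _ _))

/-- The homotopy bound applies in both directions; the strict identity `f (h c) = c` is a homotopy
with zero operator. -/
theorem persistentBetti_eq_of_retract {f : (K.Cell → F) →ₗ[F] (L.Cell → F)}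
    {h : (L.Cell → F) →ₗ[F] (K.Cell → F)} (hf : IsFilteredChainMap f) (hh : IsFilteredChainMap h)
    (H : (K.Cell → F) →ₗ[F] (K.Cell → F))
    (hH : ∀ p t c, c ∈ K.chains p t → H c ∈ K.chains (p + 1) t)
    (homotopy : ∀ c, h (f c) = c - (H (K.boundary c) + K.boundary (H c)))
    (retract : ∀ c, f (h c) = c) :
    K.persistentBetti = L.persistentBetti := by
  funext p s t
  refine le_antisymm (persistentBetti_le_of_homotopy hf hh H hH homotopy p s t)
    (persistentBetti_le_of_homotopy hh hf 0 (fun p t _ _ => zero_mem _) (fun c => ?_) p s t)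
  simp [retract]

theorem intervalMultiplicity_congr (h : K.persistentBetti = L.persistentBetti) :
    K.intervalMultiplicity = L.intervalMultiplicity := by
  funext p i j
  cases j <;> simp only [intervalMultiplicity, h]

end HomotopyInvariance

/-! ### Matrices that shift dimension and do not raise the filtration -/

section FilteredDegree

variable {K : FilteredComplex.{u} F}

/-- The matrix `X` maps cells to combinations of cells of dimension shifted by `k` and of at most
the same filtration value. -/
def HasFilteredDegree (k : ℤ) (X : Matrix K.Cell K.Cell F) : Prop :=
  ∀ x y, X x y ≠ 0 → (K.dim y : ℤ) = K.dim x + k ∧ K.g y ≤ K.g x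

theorem HasFilteredDegree.mul {k l : ℤ} {X Y : Matrix K.Cell K.Cell F}
    (hX : HasFilteredDegree k X) (hY : HasFilteredDegree l Y) :
    HasFilteredDegree (k + l) (X * Y) := by
  intro x y h
  rw [Matrix.mul_apply] at h
  obtain ⟨z, -, hz⟩ := Finset.exists_ne_zero_of_sum_ne_zero h
  have h1 := hX _ _ (left_ne_zero_of_mul hz)
  have h2 := hY _ _ (right_ne_zero_of_mul hz)
  exact ⟨by omega, by omega⟩

theorem HasFilteredDegree.sub {k : ℤ} {X Y : Matrix K.Cell K.Cell F}
    (hX : HasFilteredDegree k X) (hY : HasFilteredDegree k Y) : HasFilteredDegree k (X - Y) := by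
  intro x y h
  by_cases h1 : X x y = 0
  · exact hY x y fun h2 => h (by simp [h1, h2])
  · exact hX x y h1

open Classical in
theorem hasFilteredDegree_one : HasFilteredDegree 0 (1 : Matrix K.Cell K.Cell F) := by
  intro x y h
  have : x = y := by
    by_contra hne
    exact h (Matrix.one_apply_ne hne)
  simp [this]

theorem hasFilteredDegree_inc : HasFilteredDegree (-1) (Matrix.of K.inc) := by
  intro x y h
  have h1 := K.dim_eq _ _ h
  exact ⟨by omega, K.g_le _ _ h⟩

end FilteredDegree

/-! ### Matrix algebra of V-paths: the Morse complex as a filtered deformation retract -/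

namespace Matching

variable {K : FilteredComplex.{u} F} (M : K.Matching)

open Classical in
/-- The matrix of the inverses of the incidence indices of the matched pairs. -/
noncomputable def invMatrix : Matrix K.Cell K.Cell F :=
  Matrix.of fun b A => if M.rel b A then (K.inc A b)⁻¹ else 0

open Classical in
/-- The matrix of the incidence indices of the matched pairs. -/
noncomputable def pairMatrix : Matrix K.Cell K.Cell F :=
  Matrix.of fun A b => if M.rel b A then K.inc A b else 0

open Classical in
/-- The projection to the critical cells. -/
noncomputable def critMatrix : Matrix K.Cell K.Cell F :=
  Matrix.diagonal fun x => if M.Critical x then 1 else 0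

open Classical in
/-- The projection to the cells that are matched with one of their faces. -/
noncomputable def upperMatrix : Matrix K.Cell K.Cell F :=
  Matrix.diagonal fun A => if ∃ b, M.rel b A then 1 else 0

open Classical in
/-- The sum of the weights of all `V`-paths. -/
noncomputable def pathMatrix : Matrix K.Cell K.Cell F :=
  ∑ n ∈ Finset.range (Fintype.card K.Cell), M.stepMatrix ^ n

theorem critMatrix_mul_self : M.critMatrix * M.critMatrix = M.critMatrix := by
  classical
  simp [critMatrix]

theorem upperMatrix_mul_self : M.upperMatrix * M.upperMatrix = M.upperMatrix := by
  classical
  simp [upperMatrix]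

theorem critMatrix_mul_upperMatrix : M.critMatrix * M.upperMatrix = 0 := by
  classical
  rw [critMatrix, upperMatrix, Matrix.diagonal_mul_diagonal, ← Matrix.diagonal_zero]
  refine congrArg Matrix.diagonal (funext fun x => ?_)
  by_cases h : M.Critical x
  · have : ¬ ∃ b, M.rel b x := fun ⟨b, hb⟩ => (h b).2 hb
    simp [this]
  · simp [h]

theorem upperMatrix_mul_critMatrix : M.upperMatrix * M.critMatrix = 0 := by
  classical
  rw [← M.critMatrix_mul_upperMatrix]
  simp [critMatrix, upperMatrix, mul_comm]

theorem critMatrix_mul_invMatrix : M.critMatrix * M.invMatrix = 0 := by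
  classical
  ext x y
  simp only [critMatrix, invMatrix, Matrix.diagonal_mul, Matrix.of_apply, Matrix.zero_apply]
  split_ifs with h h'
  · exact absurd h' (h y).1
  all_goals simp

theorem upperMatrix_mul_invMatrix : M.upperMatrix * M.invMatrix = 0 := by
  classical
  ext x y
  simp only [upperMatrix, invMatrix, Matrix.diagonal_mul, Matrix.of_apply, Matrix.zero_apply]
  split_ifs with h h'
  · obtain ⟨b, hb⟩ := h
    exact absurd h' (M.not_both _ _ _ hb)
  all_goals simp

theorem invMatrix_mul_upperMatrix : M.invMatrix * M.upperMatrix = M.invMatrix := by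
  classical
  ext x y
  simp only [upperMatrix, invMatrix, Matrix.mul_diagonal, Matrix.of_apply]
  by_cases h : M.rel x y
  · simp [h, show ∃ b, M.rel b y from ⟨x, h⟩]
  · simp [h]

theorem pairMatrix_mul_critMatrix : M.pairMatrix * M.critMatrix = 0 := by
  classical
  ext x y
  simp only [critMatrix, pairMatrix, Matrix.mul_diagonal, Matrix.of_apply, Matrix.zero_apply]
  split_ifs with h h'
  · exact absurd h (h' x).1
  all_goals simp

theorem pairMatrix_mul_upperMatrix : M.pairMatrix * M.upperMatrix = 0 := by
  classical
  ext x y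
  simp only [upperMatrix, pairMatrix, Matrix.mul_diagonal, Matrix.of_apply, Matrix.zero_apply]
  split_ifs with h h'
  · obtain ⟨b, hb⟩ := h'
    exact absurd h (M.not_both _ _ _ hb)
  all_goals simp

theorem pairMatrix_mul_invMatrix : M.pairMatrix * M.invMatrix = M.upperMatrix := by
  classical
  ext x y
  rw [Matrix.mul_apply]
  simp only [upperMatrix, pairMatrix, invMatrix, Matrix.of_apply, Matrix.diagonal_apply]
  by_cases h : ∃ b, M.rel b x
  · obtain ⟨b, hb⟩ := h
    rw [Finset.sum_eq_single b]
    · by_cases hxy : x = y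
      · subst hxy
        simp [hb, M.inc_ne_zero _ _ hb, show ∃ b, M.rel b x from ⟨b, hb⟩]
      · have : ¬ M.rel b y := fun h' => hxy (M.unique_upper _ _ _ hb h')
        simp [hxy, this]
    · intro b' _ hne
      have : ¬ M.rel b' x := fun h' => hne (M.unique_lower _ _ _ h' hb)
      simp [this]
    · simp
  · have h' : ∀ b, ¬ M.rel b x := fun b hb => h ⟨b, hb⟩
    simp [h']

open Classical in
-- If `b` is matched with `A`, row `b` of `invMatrix * inc` is the boundary of `A` divided by `inc A
-- b`: entry 1 at `b`, and minus the step weights elsewhere. For unmatched or upper `b` both the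
-- step row and the `invMatrix` row vanish, which leaves the two projections.
theorem one_sub_stepMatrix :
    1 - M.stepMatrix = M.critMatrix + M.upperMatrix + M.invMatrix * Matrix.of K.inc := by
  ext b b'
  rw [Matrix.sub_apply, Matrix.add_apply, Matrix.add_apply, Matrix.mul_apply]
  simp only [critMatrix, upperMatrix, invMatrix, stepMatrix, Matrix.diagonal_apply, Matrix.of_apply,
    Matrix.one_apply]
  by_cases h : ∃ A, M.rel b A
  · obtain ⟨A, hA⟩ := h
    have h2 : ¬ ∃ c, M.rel c b := fun ⟨c, hc⟩ => M.not_both _ _ _ hc hA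
    have h3 : ¬ M.Critical b := fun h => (h A).1 hA
    have h4 : ∀ A', A' ≠ A → ¬ M.rel b A' := fun A' hne h' => hne (M.unique_upper _ _ _ h' hA)
    rw [Finset.sum_eq_single A (fun A' _ hne => by simp [h4 A' hne]) (by simp),
      Finset.sum_eq_single A (fun A' _ hne => by simp [h4 A' hne]) (by simp)]
    by_cases hbb : b = b'
    · subst hbb
      simp [hA, h2, h3, M.inc_ne_zero _ _ hA]
    · simp [hA, hbb, Ne.symm hbb, div_eq_inv_mul]
  · have h' : ∀ A, ¬ M.rel b A := fun A hA => h ⟨A, hA⟩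
    by_cases h2 : ∃ c, M.rel c b
    · obtain ⟨c, hc⟩ := h2
      have h3 : ¬ M.Critical b := fun h => (h c).2 hc
      simp [h', h3, show ∃ c, M.rel c b from ⟨c, hc⟩]
    · have h3 : M.Critical b := fun y => ⟨h' y, fun h => h2 ⟨y, h⟩⟩
      simp [h', h2, h3]

open Classical in
theorem pathMatrix_mul : M.pathMatrix *
    (M.critMatrix + M.upperMatrix + M.invMatrix * Matrix.of K.inc) = 1 := by
  rw [← one_sub_stepMatrix, pathMatrix, geom_sum_mul_neg, M.stepMatrix_pow_card, sub_zero]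

open Classical in
theorem mul_pathMatrix :
    (M.critMatrix + M.upperMatrix + M.invMatrix * Matrix.of K.inc) * M.pathMatrix = 1 := by
  rw [← one_sub_stepMatrix, pathMatrix, mul_neg_geom_sum, M.stepMatrix_pow_card, sub_zero]

/-- A V-path can leave only the lower cell of a pair, so from a critical cell there is just the path
of length zero. -/
theorem critMatrix_mul_pathMatrix : M.critMatrix * M.pathMatrix = M.critMatrix := by
  classical
  have h := congrArg (M.critMatrix * ·) M.mul_pathMatrix
  simpa [← mul_assoc, mul_add, critMatrix_mul_self, critMatrix_mul_upperMatrix,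
    critMatrix_mul_invMatrix] using h

theorem upperMatrix_mul_pathMatrix : M.upperMatrix * M.pathMatrix = M.upperMatrix := by
  classical
  have h := congrArg (M.upperMatrix * ·) M.mul_pathMatrix
  simpa [← mul_assoc, mul_add, upperMatrix_mul_self, upperMatrix_mul_critMatrix,
    upperMatrix_mul_invMatrix] using h

/-- Multiplying `mul_pathMatrix` on the left by `pairMatrix` annihilates the two projections and
turns `invMatrix` into `upperMatrix`. Thus every path sum from an upper cell cancels, except at its
own partner. -/
theorem upperMatrix_mul_inc_mul_pathMatrix :
    M.upperMatrix * (Matrix.of K.inc * M.pathMatrix) = M.pairMatrix := by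
  classical
  have h := congrArg (M.pairMatrix * ·) M.mul_pathMatrix
  simpa [← mul_assoc, mul_add, pairMatrix_mul_critMatrix, pairMatrix_mul_upperMatrix,
    pairMatrix_mul_invMatrix] using h

theorem invMatrix_mul_pathMatrix : M.invMatrix * M.pathMatrix = M.invMatrix := by
  rw [← invMatrix_mul_upperMatrix, mul_assoc, upperMatrix_mul_pathMatrix]

theorem invMatrix_mul_critMatrix : M.invMatrix * M.critMatrix = 0 := by
  rw [← invMatrix_mul_upperMatrix, mul_assoc, upperMatrix_mul_critMatrix, mul_zero]

theorem inc_mul_inc : Matrix.of K.inc * Matrix.of K.inc = 0 := by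
  ext A c
  simpa [Matrix.mul_apply] using K.inc_inc A c

open Classical in
theorem pathMatrix_mul_critMatrix : M.pathMatrix * M.critMatrix =
    1 - M.pathMatrix * M.upperMatrix - M.pathMatrix * M.invMatrix * Matrix.of K.inc := by
  rw [← M.pathMatrix_mul]
  noncomm_ring

/-- The central identity: the formula for `S * C` is substituted, its last term dies because the
boundary squares to zero, and the middle term collapses to the matched pairs. The chain map
properties and the homotopy formula all follow from it. -/
theorem pathMatrix_mul_critMatrix_mul_inc_mul_pathMatrix :
    M.pathMatrix * M.critMatrix * (Matrix.of K.inc * M.pathMatrix) =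
      Matrix.of K.inc * M.pathMatrix - M.pathMatrix * M.pairMatrix := by
  classical
  rw [pathMatrix_mul_critMatrix, sub_mul, sub_mul, one_mul, mul_assoc _ M.upperMatrix,
    upperMatrix_mul_inc_mul_pathMatrix, mul_assoc _ (Matrix.of K.inc),
    ← mul_assoc (Matrix.of K.inc) (Matrix.of K.inc), inc_mul_inc]
  simp

theorem hasFilteredDegree_pathMatrix : HasFilteredDegree 0 M.pathMatrix := by
  classical
  intro x y h
  rw [pathMatrix, Matrix.sum_apply] at h
  obtain ⟨n, -, hn⟩ := Finset.exists_ne_zero_of_sum_ne_zero h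
  rw [← pathWeight_eq] at hn
  have := M.pathWeight_dim_g n x y hn
  exact ⟨by omega, this.2⟩

theorem hasFilteredDegree_invMatrix : HasFilteredDegree 1 M.invMatrix := by
  classical
  intro x y h
  have hr : M.rel x y := by
    by_contra hr
    exact h (by simp [invMatrix, hr])
  have h1 := K.dim_eq _ _ (M.inc_ne_zero _ _ hr)
  have h2 := M.compatible _ _ hr
  exact ⟨by omega, by omega⟩

/-- The inclusion of the critical cells. -/
def critVal (x : M.morseComplex.Cell) : K.Cell := Subtype.val x

theorem critVal_injective : Function.Injective M.critVal := fun _ _ h => Subtype.ext h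

theorem critical_iff {x : K.Cell} : M.Critical x ↔ ∃ y, M.critVal y = x :=
  ⟨fun h => ⟨(⟨x, h⟩ : {x // M.Critical x}), rfl⟩, fun ⟨y, hy⟩ => hy ▸ Subtype.prop y⟩

open Classical in
/-- The matrix that restricts chains of `K` to the critical cells. -/
noncomputable def restrMatrix : Matrix K.Cell M.morseComplex.Cell F :=
  Matrix.of fun x y => if x = M.critVal y then 1 else 0

open Classical in
/-- The matrix that extends chains on the critical cells by zero. -/
noncomputable def extMatrix : Matrix M.morseComplex.Cell K.Cell F :=
  Matrix.of fun x y => if M.critVal x = y then 1 else 0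

theorem mul_restrMatrix_apply (X : Matrix K.Cell K.Cell F) (x : K.Cell)
    (y : M.morseComplex.Cell) : (X * M.restrMatrix) x y = X x (M.critVal y) := by
  classical
  rw [Matrix.mul_apply]
  simp [restrMatrix]

theorem extMatrix_mul_apply {ι : Type*} (X : Matrix K.Cell ι F) (x : M.morseComplex.Cell) (y : ι) :
    (M.extMatrix * X) x y = X (M.critVal x) y := by
  classical
  rw [Matrix.mul_apply]
  simp [extMatrix]

open Classical in
theorem extMatrix_mul_restrMatrix :
    M.extMatrix * M.restrMatrix = (1 : Matrix M.morseComplex.Cell M.morseComplex.Cell F) := by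
  ext x y
  rw [extMatrix_mul_apply]
  simp [restrMatrix, Matrix.one_apply, M.critVal_injective.eq_iff]

theorem restrMatrix_mul_extMatrix : M.restrMatrix * M.extMatrix = M.critMatrix := by
  classical
  ext x y
  rw [Matrix.mul_apply]
  simp only [critMatrix, Matrix.diagonal_apply, restrMatrix, extMatrix, Matrix.of_apply]
  by_cases h : M.Critical x
  · obtain ⟨w, rfl⟩ := M.critical_iff.1 h
    rw [Finset.sum_eq_single w]
    · simp [h]
    · intro z _ hz
      simp [M.critVal_injective.eq_iff, Ne.symm hz]
    · simp
  · rw [Finset.sum_eq_zero]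
    · simp [h]
    · intro z _
      have : x ≠ M.critVal z := fun h' => h (M.critical_iff.2 ⟨z, h'.symm⟩)
      simp [this]

theorem critMatrix_mul_restrMatrix : M.critMatrix * M.restrMatrix = M.restrMatrix := by
  classical
  rw [← restrMatrix_mul_extMatrix, Matrix.mul_assoc, extMatrix_mul_restrMatrix, Matrix.mul_one]

theorem extMatrix_mul_critMatrix : M.extMatrix * M.critMatrix = M.extMatrix := by
  classical
  rw [← restrMatrix_mul_extMatrix, ← Matrix.mul_assoc, extMatrix_mul_restrMatrix, Matrix.one_mul]

theorem inc_morseComplex : Matrix.of M.morseComplex.inc =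
    M.extMatrix * (Matrix.of K.inc * M.pathMatrix * M.restrMatrix) := by
  classical
  ext x y
  rw [extMatrix_mul_apply, mul_restrMatrix_apply, pathMatrix, ← morseInc_eq]
  rfl

/-- The matrix of the projection of `K` to the Morse complex. -/
noncomputable def projMatrix : Matrix K.Cell M.morseComplex.Cell F :=
  M.pathMatrix * M.restrMatrix

open Classical in
/-- The matrix of the embedding of the Morse complex into `K`. -/
noncomputable def embMatrix : Matrix M.morseComplex.Cell K.Cell F :=
  M.extMatrix * (1 - Matrix.of K.inc * M.pathMatrix * M.invMatrix)

/-- The error term of the central identity ends in lower matched cells, so it vanishes after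
restriction to critical cells. -/
theorem projMatrix_mul_inc :
    M.projMatrix * Matrix.of M.morseComplex.inc = Matrix.of K.inc * M.projMatrix := by
  have h1 : M.pairMatrix * M.restrMatrix = 0 := by
    rw [← critMatrix_mul_restrMatrix, ← Matrix.mul_assoc, pairMatrix_mul_critMatrix,
      Matrix.zero_mul]
  calc M.projMatrix * Matrix.of M.morseComplex.inc
      = M.pathMatrix * (M.restrMatrix * M.extMatrix) * (Matrix.of K.inc * M.pathMatrix) *
          M.restrMatrix := by
        rw [inc_morseComplex, projMatrix]
        simp only [Matrix.mul_assoc]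
    _ = Matrix.of K.inc * M.projMatrix := by
        rw [restrMatrix_mul_extMatrix, pathMatrix_mul_critMatrix_mul_inc_mul_pathMatrix,
          Matrix.sub_mul, Matrix.mul_assoc _ M.pairMatrix, h1, projMatrix]
        simp [Matrix.mul_assoc]

theorem inc_mul_embMatrix :
    Matrix.of M.morseComplex.inc * M.embMatrix = M.embMatrix * Matrix.of K.inc := by
  classical
  have h1 := M.pathMatrix_mul_critMatrix_mul_inc_mul_pathMatrix
  set D := Matrix.of K.inc with hD
  set S := M.pathMatrix
  set W := M.invMatrix
  -- The central identity multiplied by `D`; only its error term survives, and `pairMatrix * W = U`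
  -- later merges it with `S * C`.
  have h2 : D * S * M.critMatrix * (D * S) = - (D * S * M.pairMatrix) := by
    calc D * S * M.critMatrix * (D * S) = D * (S * M.critMatrix * (D * S)) := by
          simp only [mul_assoc]
      _ = (D * D) * S - D * S * M.pairMatrix := by rw [h1]; noncomm_ring
      _ = _ := by rw [hD, inc_mul_inc]; simp
  have h3 : D * S * M.critMatrix * (1 - D * S * W) = (1 - D * S * W) * D := by
    calc D * S * M.critMatrix * (1 - D * S * W)
        = D * S * M.critMatrix - D * S * M.critMatrix * (D * S) * W := by noncomm_ring
      _ = D * (S * M.critMatrix) + D * S * (M.pairMatrix * W) := by rw [h2]; noncomm_ring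
      _ = D - D * S * W * D := by
          rw [pairMatrix_mul_invMatrix, pathMatrix_mul_critMatrix]; noncomm_ring
      _ = _ := by noncomm_ring
  calc Matrix.of M.morseComplex.inc * M.embMatrix
      = M.extMatrix * (D * S * (M.restrMatrix * M.extMatrix) * (1 - D * S * W)) := by
        rw [inc_morseComplex, embMatrix]
        simp only [Matrix.mul_assoc]; rfl
    _ = _ := by
        rw [restrMatrix_mul_extMatrix, h3, embMatrix, ← Matrix.mul_assoc]

open Classical in
-- The correction term of the embedding ends in upper cells. Paths from these are trivial, so the
-- critical projection does not see it.
theorem embMatrix_mul_projMatrix :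
    M.embMatrix * M.projMatrix = (1 : Matrix M.morseComplex.Cell M.morseComplex.Cell F) := by
  have h1 : M.invMatrix * M.restrMatrix = 0 := by
    rw [← critMatrix_mul_restrMatrix, ← Matrix.mul_assoc, invMatrix_mul_critMatrix,
      Matrix.zero_mul]
  have h2 : M.extMatrix * M.pathMatrix = M.extMatrix := by
    rw [← extMatrix_mul_critMatrix, Matrix.mul_assoc, critMatrix_mul_pathMatrix]
  rw [embMatrix, projMatrix, Matrix.mul_sub, Matrix.sub_mul, Matrix.mul_one, ← Matrix.mul_assoc, h2,
    extMatrix_mul_restrMatrix]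
  have h3 : M.extMatrix * (Matrix.of K.inc * M.pathMatrix * M.invMatrix) *
      (M.pathMatrix * M.restrMatrix) = M.extMatrix * (Matrix.of K.inc * M.pathMatrix *
        (M.invMatrix * M.pathMatrix * M.restrMatrix)) := by
    simp only [Matrix.mul_assoc]
  rw [h3, invMatrix_mul_pathMatrix, h1]
  simp

open Classical in
theorem projMatrix_mul_embMatrix : M.projMatrix * M.embMatrix =
    1 - (Matrix.of K.inc * (M.pathMatrix * M.invMatrix) +
      M.pathMatrix * M.invMatrix * Matrix.of K.inc) := by
  have h1 := M.pathMatrix_mul_critMatrix_mul_inc_mul_pathMatrix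
  calc M.projMatrix * M.embMatrix
      = M.pathMatrix * (M.restrMatrix * M.extMatrix) *
          (1 - Matrix.of K.inc * M.pathMatrix * M.invMatrix) := by
        rw [projMatrix, embMatrix]
        simp only [Matrix.mul_assoc]
    _ = M.pathMatrix * M.critMatrix -
          M.pathMatrix * M.critMatrix * (Matrix.of K.inc * M.pathMatrix) * M.invMatrix := by
        rw [restrMatrix_mul_extMatrix]; noncomm_ring
    _ = _ := by
        rw [h1, sub_mul, mul_assoc M.pathMatrix, pairMatrix_mul_invMatrix,
          pathMatrix_mul_critMatrix]
        noncomm_ring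

theorem isFilteredChainMap_proj :
    IsFilteredChainMap (K := K) (L := M.morseComplex) M.projMatrix.vecMulLinear where
  mem_chains := by
    intro p t c hc y hy
    obtain ⟨x, -, hx⟩ := Finset.exists_ne_zero_of_sum_ne_zero hy
    have h1 := hc x (left_ne_zero_of_mul hx)
    have h2 : M.projMatrix x y ≠ 0 := right_ne_zero_of_mul hx
    rw [projMatrix, mul_restrMatrix_apply] at h2
    have h3 := M.hasFilteredDegree_pathMatrix _ _ h2
    refine ⟨?_, le_trans (WithTop.coe_le_coe.2 h3.2) h1.2⟩
    change K.dim (M.critVal y) = p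
    omega
  boundary_comm := by
    intro c
    change Matrix.vecMul (Matrix.vecMul c _) (Matrix.of M.morseComplex.inc) =
      Matrix.vecMul (Matrix.vecMul c (Matrix.of K.inc)) _
    rw [Matrix.vecMul_vecMul, Matrix.vecMul_vecMul, projMatrix_mul_inc]

theorem isFilteredChainMap_emb :
    IsFilteredChainMap (K := M.morseComplex) (L := K) M.embMatrix.vecMulLinear where
  mem_chains := by
    classical
    intro p t c hc y hy
    obtain ⟨x, -, hx⟩ := Finset.exists_ne_zero_of_sum_ne_zero hy
    have h1 := hc x (left_ne_zero_of_mul hx)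
    have h2 : M.embMatrix x y ≠ 0 := right_ne_zero_of_mul hx
    rw [embMatrix, extMatrix_mul_apply] at h2
    have h3 := (hasFilteredDegree_one.sub ((hasFilteredDegree_inc.mul
      M.hasFilteredDegree_pathMatrix).mul M.hasFilteredDegree_invMatrix)) _ _ h2
    refine ⟨?_, le_trans (WithTop.coe_le_coe.2 h3.2) h1.2⟩
    have h4 : K.dim (M.critVal x) = p := h1.1
    omega
  boundary_comm := by
    intro c
    change Matrix.vecMul (Matrix.vecMul c _) (Matrix.of K.inc) =
      Matrix.vecMul (Matrix.vecMul c (Matrix.of M.morseComplex.inc)) _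
    rw [Matrix.vecMul_vecMul, Matrix.vecMul_vecMul, inc_mul_embMatrix]

/-- The Morse complex of a compatible matching has the persistent Betti numbers of the complex. -/
theorem persistentBetti_morseComplex : K.persistentBetti = M.morseComplex.persistentBetti := by
  classical
  refine persistentBetti_eq_of_retract M.isFilteredChainMap_proj M.isFilteredChainMap_emb
    (M.pathMatrix * M.invMatrix).vecMulLinear ?_ ?_ ?_
  · intro p t c hc y hy
    obtain ⟨x, -, hx⟩ := Finset.exists_ne_zero_of_sum_ne_zero hy
    have h1 := hc x (left_ne_zero_of_mul hx)
    have h3 := (M.hasFilteredDegree_pathMatrix.mul M.hasFilteredDegree_invMatrix) _ _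
      (right_ne_zero_of_mul hx)
    exact ⟨by omega, le_trans (WithTop.coe_le_coe.2 h3.2) h1.2⟩
  · intro c
    change Matrix.vecMul (Matrix.vecMul c _) _ =
      c - (Matrix.vecMul (Matrix.vecMul c (Matrix.of K.inc)) _ +
        Matrix.vecMul (Matrix.vecMul c _) (Matrix.of K.inc))
    rw [Matrix.vecMul_vecMul, projMatrix_mul_embMatrix, Matrix.vecMul_sub, Matrix.vecMul_one,
      Matrix.vecMul_add, Matrix.vecMul_vecMul, Matrix.vecMul_vecMul]
  · intro c
    change Matrix.vecMul (Matrix.vecMul c _) _ = c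
    rw [Matrix.vecMul_vecMul, embMatrix_mul_projMatrix, Matrix.vecMul_one]

end Matching

/-! ### Matchings with one pair and with none -/

namespace Matching

variable {K : FilteredComplex.{u} F}

/-- The matching with a single pair of cells. -/
def single (b A : K.Cell) (h : K.inc A b ≠ 0) (hg : K.g b = K.g A) : K.Matching where
  rel x y := x = b ∧ y = A
  inc_ne_zero := by
    rintro _ _ ⟨rfl, rfl⟩
    exact h
  unique_upper := by
    rintro _ _ _ ⟨-, rfl⟩ ⟨-, rfl⟩
    rfl
  unique_lower := by
    rintro _ _ _ ⟨rfl, -⟩ ⟨rfl, -⟩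
    rfl
  not_both := by
    rintro _ _ _ ⟨rfl, rfl⟩ ⟨h', -⟩
    have := K.dim_eq _ _ h
    rw [h'] at this
    omega
  acyclic := by
    classical
    have hd := K.dim_eq _ _ h
    have hAb : A ≠ b := by
      rintro rfl
      omega
    -- A rank that drops along every edge. Dimensions are spread by a factor 3, which leaves two
    -- free values between those of `dim b` and `dim b + 1`; they go to `b` and `A`, with `b` on top
    -- because the edge between them is reversed.
    let r : K.Cell → ℕ := fun x =>
      if x = b then 3 * K.dim b + 2 else if x = A then 3 * K.dim b + 1 else 3 * K.dim x
    have hr : ∀ x y, K.MorseEdge (fun x y => x = b ∧ y = A) x y → r y < r x := by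
      rintro x y (⟨hi, hn⟩ | ⟨rfl, rfl⟩)
      · have hxy := K.dim_eq _ _ hi
        have hn' : y = b → x ≠ A := fun h1 h2 => hn ⟨h1, h2⟩
        simp only [r]
        by_cases h1 : y = b
        · have h2 : x ≠ b := by
            rintro rfl
            rw [h1] at hxy
            omega
          rw [if_pos h1, if_neg h2, if_neg (hn' h1), hxy, h1]
          omega
        · rw [if_neg h1]
          by_cases h2 : x = b
          · subst h2
            rw [if_pos rfl]
            split_ifs <;> omega
          · rw [if_neg h2]
            by_cases h3 : x = A
            · subst h3
              have h4 : y ≠ x := by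
                rintro rfl
                omega
              rw [if_pos rfl, if_neg h4]
              omega
            · rw [if_neg h3]
              split_ifs with h4
              · subst h4
                omega
              · omega
      · simp [r, hAb]
    have hr' : ∀ x y, Relation.TransGen (K.MorseEdge fun x y => x = b ∧ y = A) x y →
        r y < r x := by
      intro x y hxy
      induction hxy with
      | single h => exact hr _ _ h
      | tail _ h ih => exact (hr _ _ h).trans ih
    exact fun x hx => lt_irrefl _ (hr' x x hx)
  compatible := by
    rintro _ _ ⟨rfl, rfl⟩
    exact hg

variable (M : K.Matching)

theorem card_morseComplex_lt (h : M.IsNonempty) :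
    Nat.card M.morseComplex.Cell < Nat.card K.Cell := by
  obtain ⟨b, A, hbA⟩ := h
  exact Finite.card_subtype_lt (x := b) fun hb => (hb A).1 hbA

theorem pathWeight_succ_of_not_isNonempty (h : ¬ M.IsNonempty) (n : ℕ) (b t : K.Cell) :
    M.pathWeight (n + 1) b t = 0 := by
  have h' : ∀ b A, ¬ M.rel b A := fun b A hbA => h ⟨b, A, hbA⟩
  simp [pathWeight, h']

theorem morseInc_of_not_isNonempty (h : ¬ M.IsNonempty) (s t : K.Cell) :
    M.morseInc s t = K.inc s t := by
  classical
  -- Ensures that length zero, the only one to contribute, occurs in the range of the sum.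
  have hc : 0 < Fintype.card K.Cell := Fintype.card_pos_iff.2 ⟨s⟩
  rw [morseInc, Finset.sum_eq_single_of_mem 0 (Finset.mem_range.2 hc)]
  · simp [pathWeight]
  · intro n _ hn
    obtain ⟨m, rfl⟩ := Nat.exists_eq_succ_of_ne_zero hn
    simp [M.pathWeight_succ_of_not_isNonempty h]

/-- Without matched pairs the Morse complex is the complex itself. -/
def morseComplexIso (h : ¬ M.IsNonempty) : M.morseComplex.Iso K where
  toEquiv := Equiv.subtypeUnivEquiv fun x y => ⟨fun h' => h ⟨x, y, h'⟩, fun h' => h ⟨y, x, h'⟩⟩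
  dim_eq _ := rfl
  inc_eq x y := (M.morseInc_of_not_isNonempty h x.1 y.1).symm
  g_eq _ := rfl

end Matching

end FilteredComplex

/-! ### Fixed points of the iteration -/

namespace MorseStrategy

variable {F : Type v} [Field F] (𝕄 : MorseStrategy.{u} F)

/-- The number of cells drops until the chosen matching is empty, and then the complex is its own
Morse complex. Vitality plays no role in existence. -/
theorem exists_isIteratedMorseComplex (K : FilteredComplex.{u} F) :
    ∃ N, 𝕄.IsIteratedMorseComplex K N := by
  induction hn : Nat.card K.Cell using Nat.strong_induction_on generalizing K with
  | _ n ih =>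
    by_cases h : (𝕄 K).IsNonempty
    · obtain ⟨N, ⟨m, hm⟩, hN⟩ := ih _ (hn ▸ (𝕄 K).card_morseComplex_lt h) (𝕄.apply K) rfl
      exact ⟨N, ⟨m + 1, hm⟩, hN⟩
    · exact ⟨K, ⟨0, rfl⟩, ⟨(𝕄 K).morseComplexIso h⟩⟩

theorem persistentBetti_iterate (n : ℕ) (K : FilteredComplex.{u} F) :
    (𝕄.apply^[n] K).persistentBetti = K.persistentBetti := by
  induction n generalizing K with
  | zero => rfl
  | succ n ih =>
    rw [Function.iterate_succ_apply, ih]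
    exact (𝕄 K).persistentBetti_morseComplex.symm

variable {𝕄}

/-- In a fixed point of a vital strategy all incidences strictly increase the filtration value. -/
theorem IsVital.g_lt_of_iso (h𝕄 : 𝕄.IsVital) {N : FilteredComplex.{u} F}
    (i : (𝕄.apply N).Iso N) {A b : N.Cell} (h : N.inc A b ≠ 0) : N.g b < N.g A := by
  refine lt_of_le_of_ne (N.g_le A b h) fun hg => ?_
  have h1 := (𝕄 N).card_morseComplex_lt (h𝕄 N ⟨.single b A h hg, b, A, rfl, rfl⟩)
  exact h1.ne (Nat.card_congr i.toEquiv)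

end MorseStrategy

namespace FilteredComplex

variable {F : Type v} [Field F]

/-! ### Persistence when the boundary pairs off cells -/

section Paired

variable {K : FilteredComplex.{u} F} {P : K.Cell → K.Cell → Prop}

open Classical in
theorem sum_mul_inc_of_paired (hP : ∀ A b, K.inc A b = if P A b then 1 else 0)
    (hupper : ∀ A A' b, P A b → P A' b → A = A') {A b : K.Cell} (h : P A b) (c : K.Cell → F) :
    ∑ A, c A * K.inc A b = c A := by
  rw [Finset.sum_eq_single A]
  · simp [hP, h]
  · intro A' _ hne
    have : ¬ P A' b := fun h' => hne (hupper _ _ _ h' h)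
    simp [hP, this]
  · simp

open Classical in
/-- The persistent Betti numbers of a complex in which the boundary operator pairs off some of the
cells and vanishes on the other ones. -/
theorem persistentBetti_of_paired (hP : ∀ A b, K.inc A b = if P A b then 1 else 0)
    (hupper : ∀ A A' b, P A b → P A' b → A = A') (hlower : ∀ A b b', P A b → P A b' → b = b')
    (p : ℕ) {s t : WithTop ℤ} (hst : s ≤ t) :
    K.persistentBetti p s t = ∑ x, if (K.dim x = p ∧ ∀ y, ¬ P x y) ∧ (K.g x : WithTop ℤ) ≤ s ∧
      (∀ B, P B x → ¬ (K.g B : WithTop ℤ) ≤ t) then 1 else 0 := by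
  set Q : K.Cell → Prop := fun x => (K.dim x = p ∧ ∀ y, ¬ P x y) ∧ (K.g x : WithTop ℤ) ≤ s ∧
      (∀ B, P B x → ¬ (K.g B : WithTop ℤ) ≤ t) with hQ
  have hinc : ∀ {A b}, K.inc A b ≠ 0 → P A b := by
    intro A b h
    by_contra h'
    exact h (by simp [hP, h'])
  -- The rank is found by comparing two maps out of the cycles of level `s`: the class in level `t`,
  -- and the coordinates at the counted cells. The latter is onto and has the same kernel, so
  -- rank-nullity makes the ranks equal.
  let ρ : K.cycles p s →ₗ[F] ({x // Q x} → F) :=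
    (LinearMap.funLeft F F Subtype.val).comp (K.cycles p s).subtype
  have hρ : LinearMap.range ρ = ⊤ := by
    rw [LinearMap.range_eq_top]
    intro w
    let c : K.Cell → F := fun x => if h : Q x then w ⟨x, h⟩ else 0
    have hc : ∀ x, c x ≠ 0 → Q x := fun x hx => by
      by_contra h
      exact hx (dif_neg h)
    refine ⟨⟨c, fun x hx => ⟨(hc x hx).1.1, (hc x hx).2.1⟩, LinearMap.mem_ker.2 ?_⟩, ?_⟩
    · funext b
      refine Finset.sum_eq_zero fun A _ => ?_
      by_contra h
      exact (hc A (left_ne_zero_of_mul h)).1.2 b (hinc (right_ne_zero_of_mul h))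
    · funext x
      exact dif_pos x.2
  have hker : LinearMap.ker ((K.homologyMap p hst).comp
      ((K.boundaries p s).submoduleOf (K.cycles p s)).mkQ) = LinearMap.ker ρ := by
    ext c
    have h1 : c ∈ LinearMap.ker ((K.homologyMap p hst).comp
        ((K.boundaries p s).submoduleOf (K.cycles p s)).mkQ) ↔
          (c : K.Cell → F) ∈ K.boundaries p t :=
      Submodule.Quotient.mk_eq_zero _
    have h2 : c ∈ LinearMap.ker ρ ↔ ∀ x, Q x → (c : K.Cell → F) x = 0 :=
      ⟨fun h x hx => congrFun (LinearMap.mem_ker.1 h) ⟨x, hx⟩,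
        fun h => LinearMap.mem_ker.2 (funext fun x => h x.1 x.2)⟩
    rw [h1, h2]
    constructor
    · rintro ⟨d, hd, hdc⟩ x hx
      rw [← hdc]
      refine Finset.sum_eq_zero fun B _ => ?_
      by_contra h
      exact hx.2.2 B (hinc (right_ne_zero_of_mul h)) (hd B (left_ne_zero_of_mul h)).2
    · intro hc
      obtain ⟨c, hcs, hcz⟩ := c
      change ∀ x, Q x → c x = 0 at hc
      change c ∈ K.boundaries p t
      have hc0 : ∀ x y, P x y → c x = 0 := by
        intro x y hxy
        have h3 : ∑ A, c A * K.inc A y = 0 := congrFun (LinearMap.mem_ker.1 hcz) y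
        rwa [sum_mul_inc_of_paired hP hupper hxy] at h3
      -- A cycle has no coefficient at a killer, so a support cell outside `Q` can only fail by
      -- being killed by level `t`.
      have hkill : ∀ x, c x ≠ 0 → ∃ B, P B x ∧ (K.g B : WithTop ℤ) ≤ t := by
        intro x hx
        by_contra! h
        exact hx (hc x ⟨⟨(hcs x hx).1, fun y hy => hx (hc0 x y hy)⟩, (hcs x hx).2,
          fun B hB => not_le.2 (h B hB)⟩)
      -- The bounding chain gives each killer up to level `t` the coefficient in `c` of the cell it
      -- kills.
      refine ⟨fun B => if (K.g B : WithTop ℤ) ≤ t then ∑ x, K.inc B x * c x else 0, ?_, ?_⟩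
      · intro B hB
        have hBt : (K.g B : WithTop ℤ) ≤ t := by
          by_contra h
          exact hB (if_neg h)
        dsimp only at hB
        rw [if_pos hBt] at hB
        obtain ⟨x, -, hx⟩ := Finset.exists_ne_zero_of_sum_ne_zero hB
        refine ⟨?_, hBt⟩
        rw [K.dim_eq _ _ (left_ne_zero_of_mul hx), (hcs x (right_ne_zero_of_mul hx)).1]
      · funext x
        change ∑ B, _ * K.inc B x = c x
        by_cases hx : ∃ B, P B x
        · obtain ⟨B, hB⟩ := hx
          rw [sum_mul_inc_of_paired hP hupper hB]
          split_ifs with hBt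
          · rw [Finset.sum_eq_single x]
            · simp [hP, hB]
            · intro x' _ hne
              have : ¬ P B x' := fun h' => hne (hlower _ _ _ h' hB)
              simp [hP, this]
            · simp
          · by_contra h
            obtain ⟨B', hB', hBt'⟩ := hkill x (Ne.symm h)
            exact hBt (hupper _ _ _ hB hB' ▸ hBt')
        · have h4 : c x = 0 := by
            by_contra h
            obtain ⟨B, hB, -⟩ := hkill x h
            exact hx ⟨B, hB⟩
          rw [h4]
          refine Finset.sum_eq_zero fun B _ => ?_
          have : ¬ P B x := fun h' => hx ⟨B, h'⟩
          simp [hP, this]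
  have hrange : LinearMap.range ((K.homologyMap p hst).comp
      ((K.boundaries p s).submoduleOf (K.cycles p s)).mkQ) =
        LinearMap.range (K.homologyMap p hst) :=
    LinearMap.range_comp_of_range_eq_top _ (Submodule.range_mkQ _)
  have e1 := LinearMap.finrank_range_add_finrank_ker ((K.homologyMap p hst).comp
      ((K.boundaries p s).submoduleOf (K.cycles p s)).mkQ)
  have e2 := LinearMap.finrank_range_add_finrank_ker ρ
  rw [hrange, hker] at e1
  rw [hρ, finrank_top, Module.finrank_fintype_fun_eq_card] at e2
  have e3 : Module.finrank F (LinearMap.range (K.homologyMap p hst)) =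
      Fintype.card {x // Q x} := by omega
  rw [persistentBetti, dif_pos hst, e3, Fintype.card_subtype, Finset.card_filter]
  push_cast
  exact Finset.sum_congr rfl fun x _ => by congr

end Paired

/-! ### Reduced boundary matrices and the intervals of cells -/

section Reduction

variable {K : FilteredComplex.{u} F} {pos : K.Cell ≃ Fin (Fintype.card K.Cell)}

theorem IsSorted.g_le_of_pos_le (hpos : K.IsSorted pos) {a b : K.Cell} (h : pos a ≤ pos b) :
    K.g a ≤ K.g b := by
  rcases h.lt_or_eq with h | h
  · exact hpos a b h
  · rw [pos.injective h]

theorem exists_isLow {R : K.Cell → K.Cell → F} {A : K.Cell} (h : R A ≠ 0) :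
    ∃ b, IsLow pos R A b := by
  classical
  obtain ⟨x, hx⟩ := Function.ne_iff.1 h
  obtain ⟨b, hb, hmax⟩ := (Finset.univ.filter fun x => R A x ≠ 0).exists_max_image pos
    ⟨x, by simpa using hx⟩
  exact ⟨b, by simpa using hb, fun c hc => hmax c (by simpa using hc)⟩

theorem IsLow.unique {R : K.Cell → K.Cell → F} {A b b' : K.Cell} (h : IsLow pos R A b)
    (h' : IsLow pos R A b') : b = b' :=
  pos.injective (le_antisymm (h'.2 _ h.1) (h.2 _ h'.1))

/-- Vectors with pairwise different lowest entries are linearly independent. -/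
theorem eq_zero_of_sum_mul_eq_zero {e : K.Cell → K.Cell → F} {l : K.Cell → K.Cell} {c : K.Cell → F}
    (hlow : ∀ x, c x ≠ 0 → IsLow pos e x (l x))
    (hinj : ∀ x y, c x ≠ 0 → c y ≠ 0 → l x = l y → x = y)
    (h : ∀ z, ∑ x, c x * e x z = 0) : c = 0 := by
  classical
  by_contra hc
  obtain ⟨x₀, hx₀⟩ := Function.ne_iff.1 hc
  -- Among the vectors in use, take the one whose lowest entry is lowest of all; no other one
  -- reaches that row, so nothing cancels it.
  obtain ⟨x, hx, hmax⟩ := (Finset.univ.filter fun x => c x ≠ 0).exists_max_image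
    (fun x => pos (l x)) ⟨x₀, by simpa using hx₀⟩
  replace hx : c x ≠ 0 := by simpa using hx
  have h1 := h (l x)
  rw [Finset.sum_eq_single x] at h1
  · exact mul_ne_zero hx (hlow x hx).1 h1
  · intro y _ hne
    by_contra h2
    have hy := left_ne_zero_of_mul h2
    have h3 := (hlow y hy).2 _ (right_ne_zero_of_mul h2)
    have h4 := hmax y (by simpa using hy)
    exact hne (hinj y x hy hx (pos.injective (le_antisymm h4 h3)))
  · simp

theorem vecMulLinear_injective_of_isLow {e : Matrix K.Cell K.Cell F}
    (he : ∀ x, IsLow pos e x x) : Function.Injective e.vecMulLinear := by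
  rw [← LinearMap.ker_eq_bot, LinearMap.ker_eq_bot']
  intro c hc
  exact eq_zero_of_sum_mul_eq_zero (l := id) (fun x _ => he x) (fun _ _ _ _ h => h) (congrFun hc)

variable {R : K.Cell → K.Cell → F}

/-- A cell that creates a class that is killed later is a cycle after reduction. -/
theorem IsReduction.eq_zero_of_isLow (hR : IsReduction pos R) {A b : K.Cell}
    (h : IsLow pos R A b) : R b = 0 := by
  classical
  obtain ⟨V, hV1, hV, hRV⟩ := hR.exists_ops
  have hVlow : ∀ x, IsLow pos V x x := fun x =>
    ⟨by simp [hV1], fun c hc => (hV x c hc).1⟩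
  -- The rows of `V` are triangular, hence a basis, in which `R A` is expanded. Its boundary
  -- vanishes, so `c` is a linear relation among the `R x`; independence of the nonzero ones forces
  -- `c x = 0` unless `R x = 0`.
  obtain ⟨c, hc⟩ := LinearMap.injective_iff_surjective.1
    (vecMulLinear_injective_of_isLow (e := Matrix.of V) hVlow) (R A)
  replace hc : ∀ z, ∑ x, c x * V x z = R A z := congrFun hc
  by_contra hb
  have hcR : ∀ z, ∑ x, c x * R x z = 0 := by
    intro z
    calc ∑ x, c x * R x z = ∑ y, (∑ x, c x * V x y) * K.inc y z := by
          simp only [hRV, Finset.mul_sum, Finset.sum_mul]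
          rw [Finset.sum_comm]
          simp only [mul_assoc]
      _ = ∑ y, (∑ x, V A x * K.inc x y) * K.inc y z := by simp only [hc, hRV]
      _ = ∑ x, V A x * ∑ y, K.inc x y * K.inc y z := by
          simp only [Finset.mul_sum, Finset.sum_mul]
          rw [Finset.sum_comm]
          simp only [mul_assoc]
      _ = 0 := by simp [K.inc_inc]
  have hlow : ∀ x, ∃ y, R x ≠ 0 → IsLow pos R x y := by
    intro x
    by_cases hx : R x = 0
    · exact ⟨x, fun h => absurd hx h⟩
    · obtain ⟨y, hy⟩ := exists_isLow (pos := pos) hx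
      exact ⟨y, fun _ => hy⟩
  choose l hl using hlow
  have hne : ∀ x, (if R x = 0 then 0 else c x) ≠ 0 → R x ≠ 0 := fun x hx h0 => hx (if_pos h0)
  have hc' : (fun x => if R x = 0 then 0 else c x) = 0 := by
    refine eq_zero_of_sum_mul_eq_zero (pos := pos) (e := R) (l := l) (fun x hx => hl x (hne x hx))
      (fun x y hx hy hxy => ?_) fun z => ?_
    · exact hR.reduced x y (l x) (hl x (hne x hx)) (hxy ▸ hl y (hne y hy))
    · rw [← hcR z]
      refine Finset.sum_congr rfl fun x _ => ?_
      split_ifs with h0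
      · simp [h0]
      · rfl
  have hcb : c b = 0 := by simpa [hb] using congrFun hc' b
  have hRAb : ∑ x, c x * V x b ≠ 0 := by
    rw [hc]
    exact h.1
  obtain ⟨x, -, hx⟩ := Finset.exists_ne_zero_of_sum_ne_zero hRAb
  obtain ⟨m, hm, hmax⟩ := (Finset.univ.filter fun x => c x ≠ 0).exists_max_image pos
    ⟨x, by simpa using left_ne_zero_of_mul hx⟩
  replace hm : c m ≠ 0 := by simpa using hm
  -- By triangularity the last basis vector `m` used alone determines row `m`. Hence `m` is the
  -- lowest row of `R A`, namely `b`, contradicting `c b = 0`.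
  have h1 : R A m = c m := by
    rw [← hc m, Finset.sum_eq_single m]
    · simp [hV1]
    · intro y _ hne
      by_contra h2
      exact hne (pos.injective (le_antisymm (hmax y (by simpa using left_ne_zero_of_mul h2))
        (hV y m (right_ne_zero_of_mul h2)).1))
    · simp
  have h2 : pos m ≤ pos b := h.2 m (h1 ▸ hm)
  have h3 : pos b ≤ pos m := (hV x b (right_ne_zero_of_mul hx)).1.trans
    (hmax x (by simpa using left_ne_zero_of_mul hx))
  exact hm (pos.injective (le_antisymm h2 h3) ▸ hcb)

theorem IsReduction.exists_inc_ne_zero (hR : IsReduction pos R) {A b : K.Cell} (h : R A b ≠ 0) :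
    ∃ B, pos B ≤ pos A ∧ K.dim B = K.dim A ∧ K.inc B b ≠ 0 := by
  obtain ⟨V, -, hV, hRV⟩ := hR.exists_ops
  rw [hRV] at h
  obtain ⟨B, -, hB⟩ := Finset.exists_ne_zero_of_sum_ne_zero h
  have h1 := hV A B (left_ne_zero_of_mul hB)
  exact ⟨B, h1.1, h1.2, right_ne_zero_of_mul hB⟩

theorem IsReduction.dim_eq (hR : IsReduction pos R) {A b : K.Cell} (h : R A b ≠ 0) :
    K.dim A = K.dim b + 1 := by
  obtain ⟨B, -, hB, hi⟩ := hR.exists_inc_ne_zero h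
  rw [← hB, K.dim_eq _ _ hi]

open Classical in
/-- The complex in which the boundary of a cell `A` is the row of the lowest entry of the reduced
column of `A`. -/
noncomputable def normalForm (hpos : K.IsSorted pos) (hR : IsReduction pos R) :
    FilteredComplex.{u} F where
  Cell := K.Cell
  dim := K.dim
  inc A b := if IsLow pos R A b then 1 else 0
  g := K.g
  dim_eq A b h := by
    have : IsLow pos R A b := by
      by_contra h'
      exact h (if_neg h')
    exact hR.dim_eq this.1
  inc_inc A c := by
    refine Finset.sum_eq_zero fun b _ => ?_
    split_ifs with h1 h2
    · exact absurd (congrFun (hR.eq_zero_of_isLow h1) c) h2.1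
    all_goals simp
  g_le A b h := by
    have : IsLow pos R A b := by
      by_contra h'
      exact h (if_neg h')
    obtain ⟨B, hB, -, hi⟩ := hR.exists_inc_ne_zero this.1
    exact (K.g_le _ _ hi).trans (hpos.g_le_of_pos_le hB)

/-- A killed cell is represented by the reduced column of its killer, any other cell by its row of
`V`. Both have lowest entry at the cell itself. The former is a boundary, hence a cycle, consistent
with the vanishing reduced column of a killed cell. -/
theorem IsReduction.exists_basis (hR : IsReduction pos R) :
    ∃ e : K.Cell → K.Cell → F, (∀ x, IsLow pos e x x) ∧ (∀ x y, e x y ≠ 0 → K.dim y = K.dim x) ∧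
      (∀ A b, IsLow pos R A b → e b = R A) ∧
      ∀ x z, ∑ y, e x y * K.inc y z = R x z := by
  classical
  obtain ⟨V, hV1, hV, hRV⟩ := hR.exists_ops
  let e : K.Cell → K.Cell → F := fun x => if h : ∃ A, IsLow pos R A x then R h.choose else V x
  have he1 : ∀ A b, IsLow pos R A b → e b = R A := by
    intro A b h
    have h' : ∃ A, IsLow pos R A b := ⟨A, h⟩
    simp only [e, dif_pos h']
    rw [hR.reduced _ _ _ h'.choose_spec h]
  have he2 : ∀ x, (¬ ∃ A, IsLow pos R A x) → e x = V x := fun x h => dif_neg h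
  refine ⟨e, fun x => ?_, fun x y hxy => ?_, he1, fun x z => ?_⟩
  · by_cases h : ∃ A, IsLow pos R A x
    · obtain ⟨A, hA⟩ := h
      rw [IsLow, he1 A x hA]
      exact hA
    · rw [IsLow, he2 x h]
      exact ⟨by simp [hV1], fun c hc => (hV x c hc).1⟩
  · by_cases h : ∃ A, IsLow pos R A x
    · obtain ⟨A, hA⟩ := h
      rw [he1 A x hA] at hxy
      have h1 := hR.dim_eq hxy
      have h2 := hR.dim_eq hA.1
      omega
    · rw [he2 x h] at hxy
      exact (hV x y hxy).2
  · by_cases h : ∃ A, IsLow pos R A x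
    · obtain ⟨A, hA⟩ := h
      rw [he1 A x hA, hR.eq_zero_of_isLow hA]
      simp only [hRV, Finset.sum_mul]
      rw [Finset.sum_comm]
      simp only [mul_assoc, ← Finset.mul_sum, K.inc_inc]
      simp
    · rw [he2 x h, hRV]

/-- The triangular change of basis preserves dimension and sublevels and carries the paired boundary
to the original one, so it is a filtered isomorphism; no homotopy is needed. -/
theorem persistentBetti_normalForm (hpos : K.IsSorted pos) (hR : IsReduction pos R) :
    K.persistentBetti = (normalForm hpos hR).persistentBetti := by
  classical
  obtain ⟨e, helow, hedim, heR, hebd⟩ := hR.exists_basis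
  let φ : (K.Cell → F) →ₗ[F] (K.Cell → F) := (Matrix.of e).vecMulLinear
  have hinj : Function.Injective φ := vecMulLinear_injective_of_isLow (e := Matrix.of e) helow
  let Φ := LinearEquiv.ofInjectiveEndo φ hinj
  have hΦ : ∀ c, Φ c = φ c := fun _ => rfl
  have hchains : ∀ p t c, c ∈ K.chains p t → φ c ∈ K.chains p t := by
    intro p t c hc y hy
    obtain ⟨x, -, hx⟩ := Finset.exists_ne_zero_of_sum_ne_zero hy
    have h1 := hc x (left_ne_zero_of_mul hx)
    have h2 : e x y ≠ 0 := right_ne_zero_of_mul hx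
    exact ⟨(hedim x y h2).trans h1.1,
      (WithTop.coe_le_coe.2 (hpos.g_le_of_pos_le ((helow x).2 y h2))).trans h1.2⟩
  have hchains' : ∀ p t c, c ∈ K.chains p t → Φ.symm c ∈ K.chains p t := by
    intro p t c hc
    -- An injective endomorphism that preserves a finite-dimensional subspace maps it onto itself,
    -- so the inverse is filtered too.
    have hmap : (K.chains p t).map φ = K.chains p t :=
      Submodule.eq_of_le_of_finrank_eq (Submodule.map_le_iff_le_comap.2 (hchains p t))
        (Φ.finrank_map_eq _)
    rw [← hmap] at hc
    obtain ⟨d, hd, rfl⟩ := hc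
    rwa [← hΦ, LinearEquiv.symm_apply_apply]
  have hcomm : ∀ c, K.boundary (φ c) = φ ((normalForm hpos hR).boundary c) := by
    intro c
    have hmat : Matrix.of e * Matrix.of K.inc =
        Matrix.of (fun A b => if IsLow pos R A b then (1 : F) else 0) * Matrix.of e := by
      ext x z
      rw [Matrix.mul_apply, Matrix.mul_apply]
      refine (hebd x z).trans ?_
      by_cases hx : R x = 0
      · have h1 : ∀ b, ¬ IsLow pos R x b := fun b hb => hb.1 (congrFun hx b)
        simp [h1, hx]
      · obtain ⟨b, hb⟩ := exists_isLow (pos := pos) hx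
        rw [Finset.sum_eq_single b]
        · simp [hb, heR x b hb]
        · intro b' _ hne
          have : ¬ IsLow pos R x b' := fun h' => hne (h'.unique hb)
          simp [this]
        · simp
    change Matrix.vecMul (Matrix.vecMul c (Matrix.of e)) (Matrix.of K.inc) =
      Matrix.vecMul (Matrix.vecMul c
        (Matrix.of (fun A b => if IsLow pos R A b then (1 : F) else 0))) (Matrix.of e)
    rw [Matrix.vecMul_vecMul, Matrix.vecMul_vecMul, hmat]
  have hf : IsFilteredChainMap (K := K) (L := normalForm hpos hR) Φ.symm.toLinearMap :=
    ⟨hchains', fun c => hinj <| (hcomm (Φ.symm c)).symm.trans <|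
      (congrArg K.boundary (Φ.apply_symm_apply c)).trans (Φ.apply_symm_apply _).symm⟩
  have hh : IsFilteredChainMap (K := normalForm hpos hR) (L := K) φ := ⟨hchains, hcomm⟩
  refine persistentBetti_eq_of_retract hf hh 0 (fun _ _ _ _ => zero_mem _) (fun c => ?_)
    (fun c => Φ.symm_apply_apply c)
  exact (Φ.apply_symm_apply c).trans (by simp)

open Classical in
/-- The persistent Betti numbers count the classes that are created until `s` and not killed until
`t`. -/
theorem IsReduction.persistentBetti_eq (hpos : K.IsSorted pos) (hR : IsReduction pos R)
    (p : ℕ) {s t : WithTop ℤ} (hst : s ≤ t) :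
    K.persistentBetti p s t = ∑ x, if (K.dim x = p ∧ ∀ y, ¬ IsLow pos R x y) ∧
      (K.g x : WithTop ℤ) ≤ s ∧ (∀ B, IsLow pos R B x → ¬ (K.g B : WithTop ℤ) ≤ t)
        then 1 else 0 := by
  rw [persistentBetti_normalForm hpos hR]
  exact persistentBetti_of_paired (K := normalForm hpos hR) (P := IsLow pos R) (fun _ _ => rfl)
    hR.reduced (fun _ _ _ h h' => h.unique h') p hst

/-- The alternating sum of the four counts is taken cell by cell: a creator `x` of the right
dimension, killed by `B`, contributes 1 exactly when `g x` and `g B` are the two endpoints, and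
unkilled cells cancel. The cell `b` makes the sum positive. -/
theorem IsReduction.intervalMultiplicity_pos (hpos : K.IsSorted pos) (hR : IsReduction pos R)
    {A b : K.Cell} (h : IsLow pos R A b) (hg : K.g b < K.g A) :
    0 < K.intervalMultiplicity (K.dim b) (K.g b) (K.g A : WithTop ℤ) := by
  classical
  have hb : ∀ y, ¬ IsLow pos R b y := fun y hy => hy.1 (congrFun (hR.eq_zero_of_isLow h) y)
  have hA : ∀ B, IsLow pos R B b → B = A := fun B hB => hR.reduced _ _ _ hB h
  change 0 < (_ - _) - (_ - _)
  rw [hR.persistentBetti_eq hpos _ (by exact_mod_cast (by omega)),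
    hR.persistentBetti_eq hpos _ (by exact_mod_cast (by omega)),
    hR.persistentBetti_eq hpos _ (by exact_mod_cast (by omega)),
    hR.persistentBetti_eq hpos _ (by exact_mod_cast (by omega)),
    ← Finset.sum_sub_distrib, ← Finset.sum_sub_distrib, ← Finset.sum_sub_distrib]
  simp only [WithTop.coe_le_coe]
  refine Finset.sum_pos' (fun x _ => ?_) ⟨b, Finset.mem_univ _, ?_⟩
  · by_cases hx : K.dim x = K.dim b ∧ ∀ y, ¬ IsLow pos R x y
    · by_cases hB : ∃ B, IsLow pos R B x
      · obtain ⟨B, hB⟩ := hB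
        have hk : ∀ t, (∀ B, IsLow pos R B x → ¬ K.g B ≤ t) ↔ t < K.g B := fun t =>
          ⟨fun h => not_le.1 (h B hB), fun h B' hB' => hR.reduced _ _ _ hB hB' ▸ not_le.2 h⟩
        simp only [hx, hk, true_and, not_false_eq_true, implies_true]
        split_ifs <;> omega
      · have hk : ∀ B, ¬ IsLow pos R B x := fun B h => hB ⟨B, h⟩
        simp only [hx, hk, false_imp_iff, implies_true, true_and, and_true, sub_self, le_refl]
    · simp only [hx, false_and, if_false, sub_self, le_refl]
  · have hk : ∀ t, (∀ B, IsLow pos R B b → ¬ K.g B ≤ t) ↔ t < K.g A := fun t =>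
      ⟨fun h' => not_le.1 (h' A h), fun h' B hB => hA B hB ▸ not_le.2 h'⟩
    simp only [hb, hk, true_and, not_false_iff, implies_true, le_refl]
    split_ifs <;> omega

/-- With `t = ⊤` only unkilled creators are counted, and the difference keeps those born at `g A`,
among them `A`. -/
theorem IsReduction.intervalMultiplicity_top_pos (hpos : K.IsSorted pos) (hR : IsReduction pos R)
    {A : K.Cell} (h0 : R A = 0) (h : ∀ B, ¬ IsLow pos R B A) :
    0 < K.intervalMultiplicity (K.dim A) (K.g A) ⊤ := by
  classical
  have hA : ∀ y, ¬ IsLow pos R A y := fun y hy => hy.1 (congrFun h0 y)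
  change 0 < _ - _
  rw [hR.persistentBetti_eq hpos _ le_top, hR.persistentBetti_eq hpos _ le_top,
    ← Finset.sum_sub_distrib]
  simp only [WithTop.coe_le_coe, le_top, not_true, imp_false]
  refine Finset.sum_pos' (fun x _ => ?_) ⟨A, Finset.mem_univ _, ?_⟩
  · by_cases hx : K.dim x = K.dim A ∧ ∀ y, ¬ IsLow pos R x y
    · by_cases hB : ∀ B, ¬ IsLow pos R B x
      · simp only [hx, hB, true_and]
        simp only [not_false_eq_true, implies_true, true_and, and_true]
        split_ifs <;> omega
      · simp only [hB, and_false, if_false, sub_self, le_refl]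
    · simp only [hx, false_and, if_false, sub_self, le_refl]
  · simp [hA, h]

/-- Columns whose lowest entries are as high as possible form a reduced matrix. -/
theorem exists_isReduction (pos : K.Cell ≃ Fin (Fintype.card K.Cell)) :
    ∃ R : K.Cell → K.Cell → F, IsReduction pos R := by
  classical
  let adm : K.Cell → Set (K.Cell → F) := fun A =>
    {v | v A = 1 ∧ ∀ B, v B ≠ 0 → pos B ≤ pos A ∧ K.dim B = K.dim A}
  -- The shift by one reserves height 0 for chains with zero boundary.
  let height : (K.Cell → F) → ℕ := fun v =>
    (Finset.univ.filter fun x => K.boundary v x ≠ 0).sup fun x => (pos x : ℕ) + 1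
  have hne : ∀ A, (adm A).Nonempty := by
    intro A
    refine ⟨Pi.single A 1, by simp, fun B hB => ?_⟩
    have : B = A := by
      by_contra h
      exact hB (Pi.single_eq_of_ne h _)
    simp [this]
  have hmin : ∀ A, ∃ v ∈ adm A, ∀ w ∈ adm A, height v ≤ height w := fun A =>
    ⟨_, Function.argminOn_mem height _ (hne A), fun w hw => Function.argminOn_le height _ hw⟩
  choose V hVadm hVmin using hmin
  have hheight : ∀ A b, IsLow pos (fun A => K.boundary (V A)) A b →
      height (V A) = (pos b : ℕ) + 1 := by
    intro A b h
    apply le_antisymm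
    · refine Finset.sup_le fun x hx => ?_
      have := h.2 x (by simpa using hx)
      have : (pos x : ℕ) ≤ pos b := this
      omega
    · exact Finset.le_sup (f := fun x => (pos x : ℕ) + 1) (by simpa using h.1)
  have hdim : ∀ A b, K.boundary (V A) b ≠ 0 → K.dim A = K.dim b + 1 := by
    intro A b h
    obtain ⟨B, -, hB⟩ := Finset.exists_ne_zero_of_sum_ne_zero h
    rw [← ((hVadm A).2 B (left_ne_zero_of_mul hB)).2, K.dim_eq _ _ (right_ne_zero_of_mul hB)]
  have key : ∀ A A' b, IsLow pos (fun A => K.boundary (V A)) A b →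
      IsLow pos (fun A => K.boundary (V A)) A' b → ¬ pos A' < pos A := by
    intro A A' b h h' hlt
    have hd : K.dim A' = K.dim A := by rw [hdim A b h.1, hdim A' b h'.1]
    -- Subtracting a multiple of the earlier combination therefore keeps the coefficient 1 at `A`.
    -- The multiple `r` below cancels row `b` and so contradicts the minimality of the height.
    have hne' : V A' A = 0 := by
      by_contra hz
      exact absurd ((hVadm A').2 A hz).1 (not_le.2 hlt)
    set r : F := K.boundary (V A) b / K.boundary (V A') b with hr
    have hw : V A - r • V A' ∈ adm A := by
      refine ⟨by simp [hne', (hVadm A).1], fun B hB => ?_⟩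
      by_cases h0 : V A B = 0
      · have h1 : V A' B ≠ 0 := fun h1 => hB (by simp [h0, h1])
        have h2 := (hVadm A').2 B h1
        exact ⟨h2.1.trans hlt.le, h2.2.trans hd⟩
      · exact (hVadm A).2 B h0
    have h1 := hVmin A _ hw
    rw [hheight A b h] at h1
    have h2 : height (V A - r • V A') ≤ pos b := by
      refine Finset.sup_le fun x hx => ?_
      have hx' : K.boundary (V A) x - r * K.boundary (V A') x ≠ 0 := by
        simpa using hx
      have hxb : x ≠ b := by
        rintro rfl
        apply hx'
        rw [hr, div_mul_cancel₀ _ h'.1, sub_self]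
      have hle : pos x ≤ pos b := by
        by_cases h0 : K.boundary (V A) x = 0
        · exact h'.2 x fun h3 => hx' (by simp [h0, h3])
        · exact h.2 x h0
      exact Fin.lt_def.1 (lt_of_le_of_ne hle fun h3 => hxb (pos.injective h3))
    omega
  refine ⟨fun A => K.boundary (V A), ⟨V, fun A => (hVadm A).1, fun A => (hVadm A).2,
    fun _ _ => rfl⟩, fun A A' b h h' => pos.injective ?_⟩
  exact le_antisymm (not_lt.1 (key _ _ _ h h')) (not_lt.1 (key _ _ _ h' h))

/-- If all incidences strictly increase the filtration value, then each cell starts or terminates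
an interval of nonzero length. -/
theorem IsReduction.startsInterval_or_terminatesInterval (hpos : K.IsSorted pos)
    (hR : IsReduction pos R) (hK : ∀ A b, K.inc A b ≠ 0 → K.g b < K.g A) (A : K.Cell) :
    StartsInterval pos R A ∨ TerminatesInterval pos R A := by
  -- A nonzero entry of a reduced column comes from the boundary of a cell no later than `A`, whose
  -- value strictly exceeds that of `b`.
  have hg : ∀ A b, IsLow pos R A b → K.g b < K.g A := by
    intro A b h
    obtain ⟨B, hB, -, hi⟩ := hR.exists_inc_ne_zero h.1
    exact (hK _ _ hi).trans_le (hpos.g_le_of_pos_le hB)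
  by_cases h0 : R A = 0
  · refine Or.inl ⟨h0, ?_⟩
    by_cases hB : ∃ B, IsLow pos R B A
    · obtain ⟨B, hB⟩ := hB
      exact Or.inl ⟨B, hB, hg _ _ hB, hR.intervalMultiplicity_pos hpos hB (hg _ _ hB)⟩
    · have hB' : ∀ B, ¬ IsLow pos R B A := fun B h => hB ⟨B, h⟩
      exact Or.inr ⟨hB', hR.intervalMultiplicity_top_pos hpos h0 hB'⟩
  · obtain ⟨b, hb⟩ := exists_isLow (pos := pos) h0
    exact Or.inr ⟨b, hb, hg _ _ hb, hR.intervalMultiplicity_pos hpos hb (hg _ _ hb)⟩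

end Reduction

end FilteredComplex

theorem mainTheorem1 {F : Type v} [Field F] (𝕄 : MorseStrategy.{u} F) (h𝕄 : 𝕄.IsVital)
    (K : FilteredComplex.{u} F) :
    (∃ N : FilteredComplex.{u} F, 𝕄.IsIteratedMorseComplex K N) ∧
    ∀ N : FilteredComplex.{u} F, 𝕄.IsIteratedMorseComplex K N →
      -- Correctness
      K.SamePersistence N ∧
      -- Optimality: for every sorted boundary matrix of `N`, every reduction of it and every cell
      (∀ pos : N.Cell ≃ Fin (Fintype.card N.Cell), N.IsSorted pos →
        (∃ R : N.Cell → N.Cell → F, FilteredComplex.IsReduction pos R) ∧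
        ∀ R : N.Cell → N.Cell → F, FilteredComplex.IsReduction pos R →
          ∀ A : N.Cell, FilteredComplex.StartsInterval pos R A ∨
            FilteredComplex.TerminatesInterval pos R A) := by
  refine ⟨𝕄.exists_isIteratedMorseComplex K, ?_⟩
  rintro N ⟨⟨n, rfl⟩, ⟨i⟩⟩
  refine ⟨fun p i j _ => ?_, fun pos hpos => ⟨FilteredComplex.exists_isReduction pos,
    fun R hR => hR.startsInterval_or_terminatesInterval hpos fun A b h => h𝕄.g_lt_of_iso i h⟩⟩
  rw [FilteredComplex.intervalMultiplicity_congr (𝕄.persistentBetti_iterate n K)]
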